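/- Let $k\ge 1$ and let $\varphi$ be a Boolean function on the variables $V=\{0,\dots,k\}$, i.e. a map $\varphi:2^V\to\{0,1\}$ (not necessarily monotone). Its Euler characteristic is $e(\varphi)=\sum_{\nu\subseteq V,\ \varphi(\nu)=1}(-1)^{|\nu|}$. Let $R,S_1,\dots,S_k,T$ be pairwise distinct relation symbols, $R$ and $T$ unary and $S_1,\dots,S_k$ binary, and let $$h_{k,0}=\exists x\,\exists y\; R(x)\wedge S_1(x,y),\qquad h_{k,i}=\exists x\,\exists y\; S_i(x,y)\wedge S_{i+1}(x,y)\ \ (1\le i<k),\qquad h_{k,k}=\exists x\,\exists y\; S_k(x,y)\wedge T(y).$$ The query $Q_\varphi$ is $\varphi[0\mapsto h_{k,0},\dots,k\mapsto h_{k,k}]$: a database $D$ (a finite set of facts over $R,S_1,\dots,S_k,T$) satisfies $Q_\varphi$ if and only if $\varphi(\{i\in V: D\models h_{k,i}\})=1$. The lineage of $Q_\varphi$ on $D$ is the Boolean function whose variables are the facts of $D$ and that maps each $D'\subseteq D$ to true if and only if $D'\models Q_\varphi$. A d-D (deterministic decomposable circuit) is a Boolean circuit with variable, $\neg$-, $\wedge$-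 and $\vee$-gates, the latter two of arbitrary finite fan-in (an empty conjunction is true, an empty disjunction is false), such that any two distinct inputs of an $\wedge$-gate depend on disjoint sets of variables (no variable has a directed path to both) and any two distinct inputs of an $\vee$-gate capture disjoint Boolean functions (no valuation satisfies both). **Theorem.** If $e(\varphi)=0$, then there is an algorithm (depending on $k$ and $\varphi$ only) that, given an arbitrary database $D$, computes, in time polynomial in $|D|$, a d-D that represents the lineage of $Q_\varphi$ on $D$. Here the algorithm is a program of a random access machine whose instructions (constants, addition, truncated subtraction, indirect load and store, output, tests, while-loops) cost one step each, the constants occurring in $D$ are natural numbers occupying one machine word each, and $|D|$ is the number of facts of $D$. -/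

import Mathlib

namespace HQueries

/-! ### Boolean functions and their Euler characteristic -/

/-- A Boolean function on the variables `{0, …, k}`; a valuation is a subset of the variables. -/
abbrev BoolFun (k : ℕ) : Type := Finset (Fin (k + 1)) → Bool

/-- The Euler characteristic: the sum of `(-1) ^ |ν|` over the satisfying valuations `ν`. -/
def eulerChar {k : ℕ} (φ : BoolFun k) : ℤ :=
  ∑ ν ∈ Finset.univ.filter (fun ν : Finset (Fin (k + 1)) => φ ν = true), (-1 : ℤ) ^ ν.card

/-! ### Databases, Boolean queries, and the H-queries -/

/-- Facts (tuples) over the schema `R, S₁, …, S_k, T`, with `R`, `T` unary and `S₁, …, S_k` binary.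
Constants are natural numbers.  A database is a finite set of facts. -/
inductive DBFact (k : ℕ) : Type
  | R (a : ℕ) : DBFact k
  | S (i : {i : ℕ // 1 ≤ i ∧ i ≤ k}) (a b : ℕ) : DBFact k
  | T (b : ℕ) : DBFact k

/-- A Boolean query: it tells which (sub-)databases satisfy it. -/
abbrev Query (k : ℕ) : Type := Set (DBFact k) → Prop

/-- `S_i(a, b)` is a fact of `D`. -/
def holdsS {k : ℕ} (D : Set (DBFact k)) (i a b : ℕ) : Prop :=
  ∃ h : 1 ≤ i ∧ i ≤ k, DBFact.S ⟨i, h⟩ a b ∈ D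

/-- The conjunctive query `h_{k,i}` for `0 ≤ i ≤ k` (where `k ≥ 1`):
`h_{k,0} = ∃ x y, R(x) ∧ S₁(x,y)`,
`h_{k,i} = ∃ x y, S_i(x,y) ∧ S_{i+1}(x,y)` for `1 ≤ i < k`, and
`h_{k,k} = ∃ x y, S_k(x,y) ∧ T(y)`. -/
def hQuery (k : ℕ) (i : Fin (k + 1)) : Query k := fun D =>
  if (i : ℕ) = 0 then ∃ x y, DBFact.R x ∈ D ∧ holdsS D 1 x y
  else if (i : ℕ) < k then ∃ x y, holdsS D i x y ∧ holdsS D (i + 1) x y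
  else ∃ x y, holdsS D k x y ∧ DBFact.T y ∈ D

open Classical in
/-- The H-query `Q_φ`: the Boolean combination `φ[0 ↦ h_{k,0}, …, k ↦ h_{k,k}]`. -/
noncomputable def queryOf {k : ℕ} (φ : BoolFun k) : Query k := fun D =>
  φ (Finset.univ.filter fun i => hQuery k i D) = true

/-! ### Boolean circuits and d-Ds -/

/-- A gate of a Boolean circuit with variables in `X`; gates are referred to by their position. -/
inductive Gate (X : Type) : Type
  | var (x : X) : Gate X
  | neg (j : ℕ) : Gate X
  | and (J : List ℕ) : Gate X
  | or (J : List ℕ) : Gate X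

/-- The input gates of a gate. -/
def Gate.inputs {X : Type} : Gate X → List ℕ
  | .var _ => []
  | .neg j => [j]
  | .and J => J
  | .or J => J

/-- The value of a gate under the valuation `ν`, given the list `v` of values of the earlier gates.
An `∧`-gate without inputs is the constant true, an `∨`-gate without inputs the constant false. -/
def Gate.eval {X : Type} (ν : Set X) (v : List Prop) : Gate X → Prop
  | .var x => x ∈ ν
  | .neg j => ¬ v.getD j False
  | .and J => ∀ j ∈ J, v.getD j False
  | .or J => ∃ j ∈ J, v.getD j False

/-- A Boolean circuit: a nonempty list of gates in topological order (the inputs of each gate are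
pairwise distinct earlier gates), of arbitrary fan-in.  The last gate is the output gate. -/
structure Circuit (X : Type) : Type where
  gates : List (Gate X)
  nonempty : gates ≠ []
  inputs_lt : ∀ (i : ℕ) (g : Gate X), gates[i]? = some g → ∀ j ∈ g.inputs, j < i
  inputs_nodup : ∀ g ∈ gates, g.inputs.Nodup

namespace Circuit

variable {X : Type}

/-- The values of all gates under the valuation `ν`, computed bottom-up. -/
def values (C : Circuit X) (ν : Set X) : List Prop :=
  C.gates.foldl (fun v g => v ++ [g.eval ν v]) []

/-- The Boolean function captured by the gate number `i`. -/
def val (C : Circuit X) (i : ℕ) (ν : Set X) : Prop := (C.values ν).getD i False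

/-- The Boolean function captured by the circuit, i.e. by its output gate. -/
def eval (C : Circuit X) (ν : Set X) : Prop := C.val (C.gates.length - 1) ν

/-- `C.HasVar i x`: a variable gate labelled `x` has a directed path to the gate number `i`. -/
inductive HasVar (C : Circuit X) : ℕ → X → Prop
  | var {i : ℕ} {x : X} (h : C.gates[i]? = some (Gate.var x)) : HasVar C i x
  | step {i j : ℕ} {g : Gate X} {x : X} (h : C.gates[i]? = some g) (hj : j ∈ g.inputs)
      (hx : HasVar C j x) : HasVar C i x

/-- Every `∧`-gate is decomposable: distinct inputs depend on disjoint sets of variables. -/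
def Decomposable (C : Circuit X) : Prop :=
  ∀ (i : ℕ) (J : List ℕ), C.gates[i]? = some (Gate.and J) → ∀ j₁ ∈ J, ∀ j₂ ∈ J, j₁ ≠ j₂ →
    ∀ x, ¬ (C.HasVar j₁ x ∧ C.HasVar j₂ x)

/-- Every `∨`-gate is deterministic: distinct inputs capture disjoint Boolean functions. -/
def Deterministic (C : Circuit X) : Prop :=
  ∀ (i : ℕ) (J : List ℕ), C.gates[i]? = some (Gate.or J) → ∀ j₁ ∈ J, ∀ j₂ ∈ J, j₁ ≠ j₂ →
    ∀ ν, ¬ (C.val j₁ ν ∧ C.val j₂ ν)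

/-- A deterministic decomposable circuit (d-D). -/
def IsDD (C : Circuit X) : Prop := C.Deterministic ∧ C.Decomposable

end Circuit

/-- `C` represents the lineage of `Q` on `D`: its variables are facts of `D`, and it maps each
sub-database `D' ⊆ D` to true or false depending on whether `D'` satisfies `Q`. -/
def RepresentsLineage {k : ℕ} (C : Circuit (DBFact k)) (Q : Query k) (D : Finset (DBFact k)) : Prop :=
  (∀ x, Gate.var x ∈ C.gates → x ∈ D) ∧
    ∀ D' : Set (DBFact k), D' ⊆ (D : Set (DBFact k)) → (C.eval D' ↔ Q D')

/-! ### Random access machines with a step count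

Programs of a deterministic random access machine with registers `X₀, X₁, …` and memory cells
`M[0], M[1], …`, all holding natural numbers, and a write-only output tape.  The only arithmetic is
addition and truncated subtraction (no multiplication), so that counting one step for each
instruction is polynomially equivalent to counting the steps of a Turing machine. -/

inductive Prog : Type
  | const (r c : ℕ) : Prog -- `X_r := c`
  | add (r s t : ℕ) : Prog -- `X_r := X_s + X_t`
  | sub (r s t : ℕ) : Prog -- `X_r := X_s - X_t` (truncated)
  | load (r s : ℕ) : Prog -- `X_r := M[X_s]`
  | store (r s : ℕ) : Prog -- `M[X_r] := X_s`
  | emit (r : ℕ) : Prog -- write `X_r` on the output tape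
  | seq (p q : Prog) : Prog -- `p; q`
  | ite (r : ℕ) (p q : Prog) : Prog -- `if X_r ≠ 0 then p else q`
  | loop (r : ℕ) (p : Prog) : Prog -- `while X_r ≠ 0 do p`

/-- A configuration: registers, memory, and the output written so far. -/
structure State : Type where
  reg : ℕ → ℕ
  mem : ℕ → ℕ
  out : List ℕ

/-- The configuration `σ` with the value of the register `X_r` replaced by `n`. -/
def State.setReg (σ : State) (r n : ℕ) : State := { σ with reg := Function.update σ.reg r n }

/-- `Exec p σ t τ`: started in `σ`, the program `p` halts in `τ` after exactly `t` steps.  Every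
elementary instruction and every test takes one step. -/
inductive Exec : Prog → State → ℕ → State → Prop
  | const (σ : State) (r c : ℕ) : Exec (.const r c) σ 1 (σ.setReg r c)
  | add (σ : State) (r s t : ℕ) : Exec (.add r s t) σ 1 (σ.setReg r (σ.reg s + σ.reg t))
  | sub (σ : State) (r s t : ℕ) : Exec (.sub r s t) σ 1 (σ.setReg r (σ.reg s - σ.reg t))
  | load (σ : State) (r s : ℕ) : Exec (.load r s) σ 1 (σ.setReg r (σ.mem (σ.reg s)))
  | store (σ : State) (r s : ℕ) :
      Exec (.store r s) σ 1 { σ with mem := Function.update σ.mem (σ.reg r) (σ.reg s) }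
  | emit (σ : State) (r : ℕ) : Exec (.emit r) σ 1 { σ with out := σ.out ++ [σ.reg r] }
  | seq {p q : Prog} {σ τ υ : State} {m n : ℕ} (hp : Exec p σ m τ) (hq : Exec q τ n υ) :
      Exec (.seq p q) σ (m + n) υ
  | ite_true {r : ℕ} {p q : Prog} {σ τ : State} {m : ℕ} (h : σ.reg r ≠ 0) (hp : Exec p σ m τ) :
      Exec (.ite r p q) σ (m + 1) τ
  | ite_false {r : ℕ} {p q : Prog} {σ τ : State} {m : ℕ} (h : σ.reg r = 0) (hq : Exec q σ m τ) :
      Exec (.ite r p q) σ (m + 1) τ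
  | loop_done {r : ℕ} {p : Prog} {σ : State} (h : σ.reg r = 0) : Exec (.loop r p) σ 1 σ
  | loop_step {r : ℕ} {p : Prog} {σ τ υ : State} {m n : ℕ} (h : σ.reg r ≠ 0)
      (hp : Exec p σ m τ) (hl : Exec (.loop r p) τ n υ) : Exec (.loop r p) σ (m + n + 1) υ

/-- The machine is deterministic: the final configuration and the step count are determined. -/
theorem Exec.deterministic {p : Prog} {σ τ τ' : State} {t t' : ℕ}
    (h : Exec p σ t τ) (h' : Exec p σ t' τ') : t = t' ∧ τ = τ' := by
  induction h generalizing t' τ' with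
  | const | add | sub | load | store | emit => cases h'; exact ⟨rfl, rfl⟩
  | seq _ _ ihp ihq =>
    cases h' with
    | seq hp hq =>
      obtain ⟨rfl, rfl⟩ := ihp hp
      obtain ⟨rfl, rfl⟩ := ihq hq
      exact ⟨rfl, rfl⟩
  | ite_true h _ ih =>
    cases h' with
    | ite_true _ hp => obtain ⟨rfl, rfl⟩ := ih hp; exact ⟨rfl, rfl⟩
    | ite_false h0 _ => exact absurd h0 h
  | ite_false h _ ih =>
    cases h' with
    | ite_true h0 _ => exact absurd h h0
    | ite_false _ hp => obtain ⟨rfl, rfl⟩ := ih hp; exact ⟨rfl, rfl⟩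
  | loop_done h =>
    cases h' with
    | loop_done _ => exact ⟨rfl, rfl⟩
    | loop_step h0 _ _ => exact absurd h h0
  | loop_step h _ _ ihp ihl =>
    cases h' with
    | loop_done h0 => exact absurd h0 h
    | loop_step _ hp hl =>
      obtain ⟨rfl, rfl⟩ := ihp hp
      obtain ⟨rfl, rfl⟩ := ihl hl
      exact ⟨rfl, rfl⟩

/-! ### Encodings and the class d-D(PTIME) -/

/-- A fact as three machine words: relation number and arguments (padded with `0`). -/
def DBFact.code {k : ℕ} : DBFact k → List ℕ
  | .R a => [0, a, 0]
  | .S i a b => [i, a, b]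
  | .T b => [k + 1, b, 0]

/-- The input configuration for the facts listed in `L`: `M[0]` is the number of facts, and then
the facts follow, three words each; everything else is zero and the output is empty. -/
def inputState {k : ℕ} (L : List (DBFact k)) : State where
  reg := fun _ => 0
  mem := fun a => (L.length :: L.flatMap DBFact.code).getD a 0
  out := []

/-- A gate as a sequence of machine words (a prefix code). -/
def Gate.code {k : ℕ} : Gate (DBFact k) → List ℕ
  | .var x => 0 :: x.code
  | .neg j => [1, j]
  | .and J => 2 :: J.length :: J
  | .or J => 3 :: J.length :: J

/-- A circuit as a sequence of machine words: its gates one after the other. -/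
def Circuit.code {k : ℕ} (C : Circuit (DBFact k)) : List ℕ := C.gates.flatMap Gate.code

/-- The class d-D(PTIME): some program, on every database `D` (given by listing its facts in any
order without repetition), halts after a number of steps that is polynomial in `|D|` and outputs
a d-D that represents the lineage of `Q` on `D`.  The query is fixed (data complexity). -/
def InDDPTIME {k : ℕ} (Q : Query k) : Prop :=
  ∃ (P : Prog) (p : Polynomial ℕ), ∀ (D : Finset (DBFact k)) (L : List (DBFact k)),
    L.Nodup → (∀ x, x ∈ L ↔ x ∈ D) →
      ∃ (t : ℕ) (τ : State) (C : Circuit (DBFact k)),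
        Exec P (inputState L) t τ ∧ t ≤ p.eval D.card ∧
          τ.out = C.code ∧ C.IsDD ∧ RepresentsLineage C Q D

end HQueries

/-!
The valuations `N` and `N ∆ {l}` have opposite signs, and a set of valuations of Euler
characteristic zero can be built from the empty set by adding and removing such pairs: if `v` and
`w` have opposite signs, a shortest path from `v` to `w` moves `v` two steps at a time until it is
adjacent to `w`, and then both are removed.

For one pair, the queries that hold form `N` or `N ∆ {l}` iff those other than `h_{k,l}` are as
in `N`. The queries before `l` and those after `l` concern disjoint sets of facts, so that these two
conditions may be joined by a decomposable conjunction. Each of them is decided by an automaton of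
bounded memory that reads every fact once: from the left, in the order of the pairs `(x, y)`, so
that the facts with the same `x` are adjacent, and among them those with the same `y`; from the
right, with `x` and `y` exchanged. Unrolling the automaton, with one gate for each state after each
step, gives a deterministic decomposable circuit of polynomial size. Finally, adding a pair is a
deterministic disjunction, and removing a pair from `A` is adding it to the complement of `A` and
negating the result.
-/

namespace HQueries

/-! ### Cancelling a set of valuations in adjacent pairs -/

open scoped symmDiff

section PairReachable

variable {α : Type*}

/-- The sum of the signs of the valuations in `A`. -/
def signedCount (A : Finset (Finset α)) : ℤ := ∑ ν ∈ A, (-1) ^ ν.card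

theorem exists_opposite_signs {A : Finset (Finset α)} (hA : signedCount A = 0) {v : Finset α}
    (hv : v ∈ A) : ∃ w ∈ A, (-1 : ℤ) ^ w.card = -(-1) ^ v.card := by
  by_contra! h
  have hsame : ∀ w ∈ A, (-1 : ℤ) ^ w.card = (-1) ^ v.card := fun w hw => by
    rcases neg_one_pow_eq_or ℤ w.card with hw' | hw' <;>
      rcases neg_one_pow_eq_or ℤ v.card with hv' | hv' <;> have := h w hw <;> simp_all
  rw [signedCount, Finset.sum_congr rfl hsame, Finset.sum_const, smul_eq_zero] at hA
  rcases hA with hA | hA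
  · exact Finset.ne_empty_of_mem hv (Finset.card_eq_zero.mp hA)
  · exact pow_ne_zero _ (by norm_num) hA

variable [DecidableEq α]

theorem symmDiff_singleton_of_mem {s : Finset α} {l : α} (hl : l ∈ s) : s ∆ {l} = s.erase l := by
  ext x
  by_cases hx : x = l <;> simp [Finset.mem_symmDiff, hx, hl]

theorem symmDiff_singleton_of_notMem {s : Finset α} {l : α} (hl : l ∉ s) :
    s ∆ {l} = insert l s := by
  ext x
  by_cases hx : x = l <;> simp [Finset.mem_symmDiff, hx, hl]

theorem forall_ne_mem_iff_mem_pair {H N : Finset α} {l : α} :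
    (∀ i ≠ l, (i ∈ H ↔ i ∈ N)) ↔ H ∈ ({N, N ∆ {l}} : Finset (Finset α)) := by
  simp only [Finset.mem_insert, Finset.mem_singleton, Finset.ext_iff, Finset.mem_symmDiff]
  constructor
  · intro h
    by_cases hl : l ∈ H ↔ l ∈ N
    · exact .inl fun i => if hi : i = l then hi ▸ hl else h i hi
    · refine .inr fun i => ?_
      by_cases hi : i = l
      · subst hi
        tauto
      · simp [hi, h i hi]
  · rintro (h | h) i hi
    · exact h i
    · simp [h i, hi]

theorem neg_one_pow_card_symmDiff_singleton (ν : Finset α) (l : α) :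
    (-1 : ℤ) ^ (ν ∆ {l}).card = -(-1) ^ ν.card := by
  by_cases hl : l ∈ ν
  · rw [symmDiff_singleton_of_mem hl, ← Finset.card_erase_add_one hl, pow_succ]
    ring
  · rw [symmDiff_singleton_of_notMem hl, Finset.card_insert_of_notMem hl, pow_succ]
    ring

theorem card_symmDiff_singleton_symmDiff_lt {u w : Finset α} {l : α} (hl : l ∈ u ∆ w) :
    (u ∆ {l} ∆ w).card < (u ∆ w).card := by
  rw [symmDiff_right_comm, symmDiff_singleton_of_mem hl]
  exact Finset.card_erase_lt_of_mem hl

/-- The sets of valuations that arise from `∅` by toggling pairs of valuations that differ in one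
variable and have the same status. Such a toggle is a disjoint union or a proper difference, hence
one deterministic `∨`-gate, possibly between negations. -/
inductive PairReachable : Finset (Finset α) → Prop
  | empty : PairReachable ∅
  | toggle {A : Finset (Finset α)} (hA : PairReachable A) (N : Finset α) (l : α)
      (hN : N ∈ A ↔ N ∆ {l} ∈ A) : PairReachable (A ∆ {N, N ∆ {l}})

theorem signedCount_sdiff_pair {A : Finset (Finset α)} {v : Finset α} {l : α} (hv : v ∈ A)
    (hvl : v ∆ {l} ∈ A) : signedCount (A \ {v, v ∆ {l}}) = signedCount A := by
  have hne : v ≠ v ∆ {l} := fun h => by simpa using symmDiff_eq_left.mp h.symm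
  have hpair : ∑ ν ∈ {v, v ∆ {l}}, (-1 : ℤ) ^ ν.card = 0 := by
    rw [Finset.sum_pair hne, neg_one_pow_card_symmDiff_singleton, add_neg_cancel]
  have hsub : {v, v ∆ {l}} ⊆ A := Finset.insert_subset hv (Finset.singleton_subset_iff.mpr hvl)
  rw [signedCount, signedCount, ← Finset.sum_sdiff hsub, hpair, add_zero]

theorem signedCount_insert_erase {A : Finset (Finset α)} {v u : Finset α} (hv : v ∈ A)
    (hu : u ∉ A) (hsign : (-1 : ℤ) ^ u.card = (-1) ^ v.card) :
    signedCount (insert u (A.erase v)) = signedCount A := by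
  rw [signedCount, Finset.sum_insert fun h => hu (Finset.mem_of_mem_erase h), hsign,
    Finset.add_sum_erase A (fun ν => (-1 : ℤ) ^ ν.card) hv, signedCount]

namespace PairReachable

theorem of_toggle {A : Finset (Finset α)} {N : Finset α} {l : α} (hN : N ∈ A ↔ N ∆ {l} ∈ A)
    (h : PairReachable (A ∆ {N, N ∆ {l}})) : PairReachable A := by
  have := h.toggle N l (by simp [Finset.mem_symmDiff, hN])
  rwa [symmDiff_symmDiff_cancel_right] at this

theorem of_sdiff_pair {A : Finset (Finset α)} {v : Finset α} {l : α} (hv : v ∈ A)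
    (hvl : v ∆ {l} ∈ A) (h : PairReachable (A \ {v, v ∆ {l}})) : PairReachable A := by
  refine of_toggle (iff_of_true hv hvl) ?_
  rwa [symmDiff_of_ge (Finset.insert_subset hv (Finset.singleton_subset_iff.mpr hvl))]

theorem of_insert_erase {A : Finset (Finset α)} {v : Finset α} {i j : α} (hv : v ∈ A)
    (hvi : v ∆ {i} ∉ A) (hvij : v ∆ {i} ∆ {j} ∉ A)
    (h : PairReachable (insert (v ∆ {i} ∆ {j}) (A.erase v))) : PairReachable A := by
  refine of_toggle (iff_of_false hvi hvij) (of_sdiff_pair (v := v ∆ {i}) (l := i) ?_ ?_ ?_)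
  · simp [Finset.mem_symmDiff, hvi]
  · rw [symmDiff_symmDiff_cancel_right]
    simp only [Finset.mem_symmDiff, Finset.mem_insert, Finset.mem_singleton]
    exact .inl ⟨hv, not_or.mpr
      ⟨ne_of_mem_of_not_mem hv hvi, ne_of_mem_of_not_mem hv hvij⟩⟩
  · convert h using 1
    ext u
    rw [symmDiff_symmDiff_cancel_right]
    simp only [Finset.mem_sdiff, Finset.mem_symmDiff, Finset.mem_insert, Finset.mem_singleton,
      Finset.mem_erase]
    have : v ≠ v ∆ {i} := ne_of_mem_of_not_mem hv hvi
    have : v ≠ v ∆ {i} ∆ {j} := ne_of_mem_of_not_mem hv hvij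
    have : v ∆ {i} ≠ v ∆ {i} ∆ {j} := fun h => by simpa using symmDiff_eq_left.mp h.symm
    grind

theorem of_opposite_signs {n : ℕ}
    (hsmaller : ∀ B : Finset (Finset α), B.card < n → signedCount B = 0 → PairReachable B)
    {A : Finset (Finset α)} {v w : Finset α} (hn : A.card = n) (hA : signedCount A = 0)
    (hv : v ∈ A) (hw : w ∈ A) (hsign : (-1 : ℤ) ^ w.card = -(-1) ^ v.card) :
    PairReachable A := by
  induction hd : (v ∆ w).card using Nat.strong_induction_on generalizing A v with
  | _ d closer =>
    have hvw : v ≠ w := by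
      rintro rfl
      exact pow_ne_zero v.card (by norm_num) (self_eq_neg.mp hsign)
    obtain ⟨i, hi⟩ := Finset.symmDiff_nonempty.mpr hvw
    by_cases hvi : v ∆ {i} ∈ A
    · refine of_sdiff_pair hv hvi (hsmaller _ ?_ (signedCount_sdiff_pair hv hvi ▸ hA))
      exact hn ▸ Finset.card_lt_card (Finset.sdiff_ssubset
        (Finset.insert_subset hv (Finset.singleton_subset_iff.mpr hvi)) (by simp))
    obtain ⟨j, hj⟩ := Finset.symmDiff_nonempty.mpr fun h : v ∆ {i} = w => hvi (h ▸ hw)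
    have hcloser : (v ∆ {i} ∆ {j} ∆ w).card < d := hd ▸
      (card_symmDiff_singleton_symmDiff_lt hj).trans (card_symmDiff_singleton_symmDiff_lt hi)
    have hsign' : (-1 : ℤ) ^ (v ∆ {i} ∆ {j}).card = (-1) ^ v.card := by
      simp only [neg_one_pow_card_symmDiff_singleton, neg_neg]
    by_cases hvij : v ∆ {i} ∆ {j} ∈ A
    · exact closer _ hcloser hn hA hvij hw (hsign' ▸ hsign) rfl
    refine of_insert_erase hv hvi hvij (closer _ hcloser ?_ ?_ (Finset.mem_insert_self _ _)
      (Finset.mem_insert_of_mem (Finset.mem_erase.mpr ⟨hvw.symm, hw⟩)) (hsign' ▸ hsign) rfl)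
    · rw [Finset.card_insert_of_notMem fun h => hvij (Finset.mem_of_mem_erase h),
        Finset.card_erase_add_one hv, hn]
    · rw [signedCount_insert_erase hv hvij hsign', hA]

theorem of_signedCount_eq_zero {A : Finset (Finset α)} (hA : signedCount A = 0) :
    PairReachable A := by
  induction hn : A.card using Nat.strong_induction_on generalizing A with
  | _ n smaller =>
    obtain rfl | ⟨v, hv⟩ := A.eq_empty_or_nonempty
    · exact empty
    obtain ⟨w, hw, hsign⟩ := exists_opposite_signs hA hv
    exact of_opposite_signs (fun B hB hB0 => smaller _ hB hB0 rfl) hn hA hv hw hsign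

end PairReachable

end PairReachable

/-! ### Circuits as lists of gates -/

section Circuits

variable {X : Type}

section BottomUp

variable {β : Type*} (F : List β → Gate X → β)

/-- Bottom-up evaluation of a list of gates, where `F` combines the results for the earlier gates;
`Circuit.values` is the instance `F v g = g.eval ν v`. -/
def bottomUp (G : List (Gate X)) : List β := G.foldl (fun v g => v ++ [F v g]) []

theorem bottomUp_concat (G : List (Gate X)) (g : Gate X) :
    bottomUp F (G ++ [g]) = bottomUp F G ++ [F (bottomUp F G) g] := by
  simp only [bottomUp, List.foldl_append, List.foldl_cons, List.foldl_nil]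

theorem length_bottomUp (G : List (Gate X)) : (bottomUp F G).length = G.length := by
  induction G using List.reverseRecOn with
  | nil => rfl
  | append_singleton G g ih => simp [bottomUp_concat, ih]

theorem bottomUp_prefix {G G' : List (Gate X)} (h : G <+: G') : bottomUp F G <+: bottomUp F G' := by
  obtain ⟨H, rfl⟩ := h
  induction H using List.reverseRecOn with
  | nil => simp
  | append_singleton H g ih =>
    rw [← List.append_assoc, bottomUp_concat]
    exact ih.trans (List.prefix_append _ _)

theorem getD_bottomUp_of_prefix {G G' : List (Gate X)} (h : G <+: G') {j : ℕ} (hj : j < G.length)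
    (b : β) : (bottomUp F G').getD j b = (bottomUp F G).getD j b := by
  obtain ⟨v, hv⟩ := bottomUp_prefix F h
  rw [← hv, List.getD_append _ _ _ _ (by rwa [length_bottomUp])]

theorem getD_bottomUp {G : List (Gate X)} {i : ℕ} {g : Gate X} (hg : G[i]? = some g) (b : β) :
    (bottomUp F G).getD i b = F (bottomUp F (G.take i)) g := by
  obtain ⟨hi, rfl⟩ := List.getElem?_eq_some_iff.mp hg
  rw [getD_bottomUp_of_prefix F (List.take_prefix (i + 1) G) (by simp [hi]),
    ← List.take_concat_get' G i hi, bottomUp_concat, List.getD_append_right _ _ _ _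
      (by simp [length_bottomUp])]
  simp [length_bottomUp, hi.le]

end BottomUp

/-- The variables with a directed path to a gate, given those of the earlier gates. -/
def Gate.vars (v : List (Set X)) : Gate X → Set X
  | .var x => {x}
  | g => {x | ∃ j ∈ g.inputs, x ∈ v.getD j ∅}

theorem Gate.eval_congr {g : Gate X} {ν : Set X} {v v' : List Prop}
    (h : ∀ j ∈ g.inputs, v.getD j False = v'.getD j False) : g.eval ν v = g.eval ν v' := by
  cases g with
  | var x => rfl
  | neg j => exact congrArg Not (h j (List.mem_singleton_self j))
  | and J => exact propext (forall₂_congr fun j hj => iff_of_eq (h j hj))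
  | or J => exact propext (exists_congr fun j => and_congr_right fun hj => iff_of_eq (h j hj))

theorem Gate.vars_congr {g : Gate X} {v v' : List (Set X)}
    (h : ∀ j ∈ g.inputs, v.getD j ∅ = v'.getD j ∅) : g.vars v = g.vars v' := by
  cases g with
  | var x => rfl
  | neg | and | or =>
    exact Set.ext fun x => exists_congr fun j => and_congr_right fun hj => by rw [h j hj]

/-- The Boolean function captured by the gate number `j`. -/
def valAt (G : List (Gate X)) (j : ℕ) (ν : Set X) : Prop :=
  (bottomUp (fun v g => g.eval ν v) G).getD j False

/-- The variables that the gate number `j` depends on. -/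
def varsAt (G : List (Gate X)) (j : ℕ) : Set X := (bottomUp Gate.vars G).getD j ∅

theorem valAt_of_prefix {G G' : List (Gate X)} (h : G <+: G') {j : ℕ} (hj : j < G.length)
    (ν : Set X) : valAt G' j ν = valAt G j ν :=
  getD_bottomUp_of_prefix _ h hj _

theorem varsAt_of_prefix {G G' : List (Gate X)} (h : G <+: G') {j : ℕ} (hj : j < G.length) :
    varsAt G' j = varsAt G j :=
  getD_bottomUp_of_prefix _ h hj _

/-- The conditions on a new gate `g` after the gates `G` in a d-D with variables in `D`. -/
structure Fits (D : Set X) (G : List (Gate X)) (g : Gate X) : Prop where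
  inputs_lt : ∀ j ∈ g.inputs, j < G.length
  inputs_nodup : g.inputs.Nodup
  var_mem : ∀ x, g = .var x → x ∈ D
  decomposable : ∀ J, g = .and J → ∀ i ∈ J, ∀ j ∈ J, i ≠ j → Disjoint (varsAt G i) (varsAt G j)
  deterministic : ∀ J, g = .or J → ∀ i ∈ J, ∀ j ∈ J, i ≠ j → ∀ ν, ¬(valAt G i ν ∧ valAt G j ν)

/-- `G` lists the gates of a d-D with variables in `D`, in topological order. -/
def IsDDList (D : Set X) (G : List (Gate X)) : Prop :=
  ∀ i g, G[i]? = some g → Fits D (G.take i) g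

/-- The gate number `j` captures the Boolean function `s` and depends on variables in `d` only. -/
structure Computes (G : List (Gate X)) (j : ℕ) (s : Set X → Prop) (d : Set X) : Prop where
  lt : j < G.length
  val : ∀ ν, valAt G j ν ↔ s ν
  vars : varsAt G j ⊆ d

/-- After the gates `G` of a d-D with variables in `D`, the gate `g` may be added; it captures the
Boolean function `s` and depends on variables in `d` only. -/
structure Realizes (D : Set X) (G : List (Gate X)) (g : Gate X) (s : Set X → Prop) (d : Set X) :
    Prop where
  fits : Fits D G g
  eval : ∀ ν, g.eval ν (bottomUp (fun v g => g.eval ν v) G) ↔ s ν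
  vars : g.vars (bottomUp Gate.vars G) ⊆ d

variable {D d d' : Set X} {G G' : List (Gate X)} {g : Gate X} {s s' : Set X → Prop} {i j : ℕ}

theorem Computes.of_prefix (h : Computes G j s d) (hG : G <+: G') : Computes G' j s d where
  lt := h.lt.trans_le hG.length_le
  val ν := by rw [valAt_of_prefix hG h.lt, h.val]
  vars := by rw [varsAt_of_prefix hG h.lt]; exact h.vars

theorem Computes.imp (h : Computes G j s d) (hs : ∀ ν, s ν ↔ s' ν) (hd : d ⊆ d') :
    Computes G j s' d' :=
  ⟨h.lt, fun ν => (h.val ν).trans (hs ν), h.vars.trans hd⟩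

theorem Fits.of_prefix (h : Fits D G g) (hG : G <+: G') : Fits D G' g where
  inputs_lt j hj := (h.inputs_lt j hj).trans_le hG.length_le
  inputs_nodup := h.inputs_nodup
  var_mem := h.var_mem
  decomposable := by
    rintro J rfl i hi j hj hij
    rw [varsAt_of_prefix hG (h.inputs_lt i hi), varsAt_of_prefix hG (h.inputs_lt j hj)]
    exact h.decomposable J rfl i hi j hj hij
  deterministic := by
    rintro J rfl i hi j hj hij ν
    rw [valAt_of_prefix hG (h.inputs_lt i hi), valAt_of_prefix hG (h.inputs_lt j hj)]
    exact h.deterministic J rfl i hi j hj hij ν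

theorem isDDList_nil : IsDDList D [] := fun _ _ h => by simp at h

theorem IsDDList.concat (hG : IsDDList D G) (hg : Fits D G g) : IsDDList D (G ++ [g]) := by
  intro i g' hi
  rcases lt_or_ge i G.length with hlt | hge
  · rw [List.take_append_of_le_length hlt.le]
    exact hG i g' (by rwa [List.getElem?_append_left hlt] at hi)
  · obtain ⟨rfl, rfl⟩ : i = G.length ∧ g = g' := by
      rw [List.getElem?_append_right hge, List.getElem?_singleton] at hi
      split_ifs at hi with h0
      exact ⟨by omega, by simpa using hi⟩
    rwa [List.take_left]

namespace Realizes

theorem imp (h : Realizes D G g s d) (hs : ∀ ν, s ν ↔ s' ν) (hd : d ⊆ d') :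
    Realizes D G g s' d' :=
  ⟨h.fits, fun ν => (h.eval ν).trans (hs ν), h.vars.trans hd⟩

theorem computes (h : Realizes D G g s d) : Computes (G ++ [g]) G.length s d := by
  have hg : (G ++ [g])[G.length]? = some g := by simp
  refine ⟨by simp, fun ν => ?_, ?_⟩
  · rw [valAt, getD_bottomUp _ hg, List.take_left]
    exact h.eval ν
  · rw [varsAt, getD_bottomUp _ hg, List.take_left]
    exact h.vars

theorem of_prefix (h : Realizes D G g s d) (hG : G <+: G') : Realizes D G' g s d where
  fits := h.fits.of_prefix hG
  eval ν := by
    rw [← h.eval ν]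
    exact iff_of_eq (Gate.eval_congr fun j hj => valAt_of_prefix hG (h.fits.inputs_lt j hj) ν)
  vars := by
    rw [Gate.vars_congr fun j hj => varsAt_of_prefix hG (h.fits.inputs_lt j hj)]
    exact h.vars

theorem var {x : X} (hx : x ∈ D) : Realizes D G (.var x) (x ∈ ·) {x} :=
  ⟨⟨by simp [Gate.inputs], by simp [Gate.inputs], by simpa using hx, by simp, by simp⟩,
    fun _ => Iff.rfl, subset_rfl⟩

theorem neg (h : Computes G j s d) : Realizes D G (.neg j) (fun ν => ¬s ν) d := by
  refine ⟨⟨by simpa [Gate.inputs] using h.lt, by simp [Gate.inputs], by simp, by simp, by simp⟩,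
    fun ν => not_congr (h.val ν), ?_⟩
  rintro x ⟨_, hj, hx⟩
  rw [Gate.inputs, List.mem_singleton] at hj
  exact h.vars (hj ▸ hx)

theorem and_nil : Realizes D G (.and []) (fun _ => True) d :=
  ⟨⟨by simp [Gate.inputs], by simp [Gate.inputs], by simp, by simp, by simp⟩,
    fun ν => by simp [Gate.eval], by simp [Gate.vars, Gate.inputs]⟩

theorem and_pair (hi : Computes G i s d) (hj : Computes G j s' d') (hij : i ≠ j)
    (hd : Disjoint d d') : Realizes D G (.and [i, j]) (fun ν => s ν ∧ s' ν) (d ∪ d') := by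
  refine ⟨⟨by simp [Gate.inputs, hi.lt, hj.lt], by simpa [Gate.inputs] using hij, by simp, ?_,
    by simp⟩, fun ν => ?_, ?_⟩
  · have hdisj := hd.mono hi.vars hj.vars
    rintro J ⟨⟩ a ha b hb hab
    rcases List.mem_pair.mp ha with rfl | rfl <;> rcases List.mem_pair.mp hb with rfl | rfl
    · exact absurd rfl hab
    · exact hdisj
    · exact hdisj.symm
    · exact absurd rfl hab
  · rw [← hi.val, ← hj.val]
    exact List.forall_mem_cons.trans (and_congr_right fun _ => List.forall_mem_singleton)
  · rintro x ⟨a, ha, hx⟩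
    rcases List.mem_pair.mp ha with rfl | rfl
    · exact .inl (hi.vars hx)
    · exact .inr (hj.vars hx)

theorem or_map {ι : Type*} {l : List ι} {p : ι → ℕ} {s : ι → Set X → Prop}
    (h : ∀ a ∈ l, Computes G (p a) (s a) d) (hp : (l.map p).Nodup)
    (hdet : ∀ a ∈ l, ∀ b ∈ l, a ≠ b → ∀ ν, ¬(s a ν ∧ s b ν)) :
    Realizes D G (.or (l.map p)) (fun ν => ∃ a ∈ l, s a ν) d := by
  refine ⟨⟨by simpa [Gate.inputs] using fun a ha => (h a ha).lt, hp, by simp, by simp, ?_⟩,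
    fun ν => ?_, ?_⟩
  · rintro J ⟨⟩ i hi j hj hij ν
    obtain ⟨a, ha, rfl⟩ := List.mem_map.mp hi
    obtain ⟨b, hb, rfl⟩ := List.mem_map.mp hj
    rw [(h a ha).val, (h b hb).val]
    exact hdet a ha b hb (ne_of_apply_ne p hij) ν
  · have hval : (∃ j ∈ l.map p, valAt G j ν) ↔ ∃ a ∈ l, valAt G (p a) ν := by simp
    exact hval.trans (exists_congr fun a => and_congr_right fun ha => (h a ha).val ν)
  · rintro x ⟨j, hj, hx⟩
    obtain ⟨a, ha, rfl⟩ := List.mem_map.mp hj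
    exact (h a ha).vars hx

theorem or_pair (hi : Computes G i s d) (hj : Computes G j s' d) (hij : i ≠ j)
    (hdet : ∀ ν, ¬(s ν ∧ s' ν)) : Realizes D G (.or [i, j]) (fun ν => s ν ∨ s' ν) d := by
  refine (or_map (l := [(i, s), (j, s')]) (p := Prod.fst) (s := Prod.snd) (d := d)
    (by simp [hi, hj]) (by simpa using hij) ?_).imp (fun ν => by simp) subset_rfl
  simpa using ⟨fun _ ν hs hs' => hdet ν ⟨hs, hs'⟩, fun _ ν hs' hs => hdet ν ⟨hs, hs'⟩⟩

end Realizes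

theorem IsDDList.append_map {ι : Type*} {l : List ι} {g : ι → Gate X} {s : ι → Set X → Prop}
    {d : ι → Set X} (hG : IsDDList D G) (h : ∀ a ∈ l, Realizes D G (g a) (s a) (d a)) :
    IsDDList D (G ++ l.map g) ∧
      ∀ i a, l[i]? = some a → Computes (G ++ l.map g) (G.length + i) (s a) (d a) := by
  induction l using List.reverseRecOn with
  | nil => exact ⟨by simpa using hG, by simp⟩
  | append_singleton l b ih =>
    obtain ⟨ihG, ihl⟩ := ih fun a ha => h a (List.mem_append_left _ ha)
    have hb := (h b (by simp)).of_prefix (List.prefix_append G (l.map g))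
    rw [List.map_append, List.map_singleton, ← List.append_assoc]
    refine ⟨ihG.concat hb.fits, fun i a hi => ?_⟩
    rcases lt_or_ge i l.length with hlt | hge
    · rw [List.getElem?_append_left hlt] at hi
      exact (ihl i a hi).of_prefix (List.prefix_append _ _)
    · obtain ⟨rfl, rfl⟩ : i = l.length ∧ b = a := by
        rw [List.getElem?_append_right hge, List.getElem?_singleton] at hi
        split_ifs at hi with h0
        exact ⟨by omega, by simpa using hi⟩
      simpa using hb.computes

namespace IsDDList

/-- A nonempty list of gates of a d-D, as a circuit. -/
def toCircuit (hG : IsDDList D G) (hne : G ≠ []) : Circuit X where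
  gates := G
  nonempty := hne
  inputs_lt i g hg j hj := by simpa using ((hG i g hg).inputs_lt j hj).trans_le (by simp)
  inputs_nodup g hg := by
    obtain ⟨i, hi⟩ := List.mem_iff_getElem?.mp hg
    exact (hG i g hi).inputs_nodup

theorem mem_of_var_mem (hG : IsDDList D G) {x : X} (hx : Gate.var x ∈ G) : x ∈ D := by
  obtain ⟨i, hi⟩ := List.mem_iff_getElem?.mp hx
  exact (hG i _ hi).var_mem x rfl

end IsDDList

theorem mem_varsAt_of_hasVar {C : Circuit X} {x : X} (h : C.HasVar j x) :
    x ∈ varsAt C.gates j := by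
  induction h with
  | var h =>
    rw [varsAt, getD_bottomUp _ h]
    exact rfl
  | @step i j g x h hj _ ih =>
    have hji : j < (C.gates.take i).length := by
      have := (List.getElem?_eq_some_iff.mp h).1
      simpa using ⟨C.inputs_lt i g h j hj, (C.inputs_lt i g h j hj).trans this⟩
    rw [varsAt_of_prefix (List.take_prefix i _) hji] at ih
    rw [varsAt, getD_bottomUp _ h]
    cases g with
    | var => simp [Gate.inputs] at hj
    | neg | and | or => exact ⟨j, hj, ih⟩

theorem IsDDList.isDD (hG : IsDDList D G) (hne : G ≠ []) : (hG.toCircuit hne).IsDD := by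
  constructor
  · intro i J hJ
    exact ((hG i _ hJ).of_prefix (List.take_prefix i G)).deterministic J rfl
  · intro i J hJ j₁ h₁ j₂ h₂ hne x hx
    have hfits := (hG i _ hJ).of_prefix (List.take_prefix i G)
    exact Set.disjoint_left.mp (hfits.decomposable J rfl j₁ h₁ j₂ h₂ hne)
      (mem_varsAt_of_hasVar hx.1) (mem_varsAt_of_hasVar hx.2)

end Circuits

/-! ### Unrolling an automaton into a circuit -/

section Steps

variable {α X : Type*}

/-- One step of an automaton with states `α` that reads variables in `X`: an unconditional
transition, or a transition that takes place if the variable `x` is true. -/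
inductive Step (α X : Type*)
  | map (g : α → α)
  | read (x : X) (δ : α → α)

namespace Step

/-- The variables that a step reads. -/
def reads : Step α X → List X
  | map _ => []
  | read x _ => [x]

open Classical in
/-- The state after a step, under the valuation `ν`. -/
noncomputable def run (ν : Set X) (a : α) : Step α X → α
  | map g => g a
  | read x δ => if x ∈ ν then δ a else a

/-- The state after a sequence of steps, under the valuation `ν`. -/
noncomputable def runAll (ν : Set X) (a : α) (w : List (Step α X)) : α := w.foldl (Step.run ν) a

theorem runAll_append (ν : Set X) (a : α) (w w' : List (Step α X)) :
    runAll ν a (w ++ w') = runAll ν (runAll ν a w) w' :=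
  List.foldl_append

end Step

end Steps

section Layers

variable {X : Type} {α β : Type*} [Finite α] [Finite β]

/-- The position of `a` in a fixed enumeration of the finite type `α`. -/
noncomputable def index (a : α) : ℕ := Finite.equivFin α a

variable (α) in
/-- All elements of the finite type `α`, in the order given by `index`. -/
noncomputable def states : List α := List.ofFn (Finite.equivFin α).symm

theorem index_lt (a : α) : index a < Nat.card α := (Finite.equivFin α a).isLt

theorem index_injective : Function.Injective (index : α → ℕ) :=
  Fin.val_injective.comp (Finite.equivFin α).injective

theorem length_states : (states α).length = Nat.card α := List.length_ofFn

theorem getElem?_states_index (a : α) : (states α)[index a]? = some a := by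
  simp [states, index]

theorem mem_states (a : α) : a ∈ states α := List.mem_of_getElem? (getElem?_states_index a)

theorem nodup_states : (states α).Nodup := List.nodup_ofFn.mpr (Finite.equivFin α).symm.injective

open Classical in
/-- The `∨`-gate over those gates of the layer starting at `S` whose states satisfy `p`. -/
noncomputable def acceptGate (S : ℕ) (p : α → Prop) : Gate X :=
  .or (((states α).filter (p ·)).map fun a => S + index a)

/-- The layer that applies `g` to the state in the layer starting at `S`. -/
noncomputable def mapGates (S : ℕ) (g : α → β) : List (Gate X) :=
  (states β).map fun b => acceptGate S fun a => g a = b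

/-- The layers that, placed at position `n`, pair the state in the layer starting at `S` with the
value of the variable `x`. -/
noncomputable def pairGates (S n : ℕ) : List (Gate X) :=
  (states (α × Bool)).map fun p => .and [S + index p.1, n + if p.2 then 0 else 1]

/-- The gates that, placed at position `n`, apply `δ` to the state in the layer starting at `S` if
the variable `x` is true. Pairing the state with the value of `x` first keeps the `∧`-gates
decomposable and the `∨`-gates deterministic. -/
noncomputable def readGates (S n : ℕ) (x : X) (δ : α → α) : List (Gate X) :=
  .var x :: .neg n :: (pairGates (α := α) S n ++
    mapGates (n + 2) fun p : α × Bool => if p.2 then δ p.1 else p.1)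

/-- The gates number `S`, `S + 1`, … test for each state `a` whether the function `st` of the
valuation, which depends on variables in `d` only, takes the value `a`. -/
def Layer (G : List (Gate X)) (S : ℕ) (st : Set X → α) (d : Set X) : Prop :=
  ∀ a, Computes G (S + index a) (fun ν => st ν = a) d

theorem length_mapGates (S : ℕ) (g : α → β) :
    (mapGates S g : List (Gate X)).length = Nat.card β := by
  rw [mapGates, List.length_map, length_states]

theorem length_readGates (S n : ℕ) (x : X) (δ : α → α) :
    (readGates S n x δ).length = Nat.card (α × Bool) + 2 + Nat.card α := by
  simp only [readGates, pairGates, List.length_cons, List.length_append, List.length_map,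
    length_states, length_mapGates]
  omega

section Layer

variable {D d : Set X} {G : List (Gate X)} {S : ℕ} {st : Set X → α}

theorem Layer.realizes_acceptGate (h : Layer G S st d) (p : α → Prop) :
    Realizes D G (acceptGate S p) (fun ν => p (st ν)) d := by
  classical
  refine (Realizes.or_map (s := fun a ν => st ν = a) (fun a _ => h a) ?_ ?_).imp (fun ν => ?_)
    subset_rfl
  · exact (nodup_states.filter _).map fun a b hab => index_injective (Nat.add_left_cancel hab)
  · rintro a - b - hab ν ⟨rfl, h⟩
    exact hab h
  · simp [mem_states]

theorem Layer.map (hG : IsDDList D G) (h : Layer G S st d) (g : α → β) :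
    IsDDList D (G ++ mapGates S g) ∧
      Layer (G ++ mapGates S g) G.length (fun ν => g (st ν)) d := by
  obtain ⟨hG', h'⟩ := hG.append_map (l := states β)
    (g := fun b => acceptGate S fun a => g a = b) (s := fun b ν => g (st ν) = b) (d := fun _ => d)
    fun b _ => h.realizes_acceptGate _
  exact ⟨hG', fun b => h' _ b (getElem?_states_index b)⟩

open Classical in
theorem Layer.pair (hG : IsDDList D G) (h : Layer G S st d) {x : X} {n : ℕ} (hx : x ∉ d)
    (hSn : ∀ a : α, S + index a < n) (hvar : Computes G n (x ∈ ·) {x})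
    (hneg : Computes G (n + 1) (x ∉ ·) {x}) :
    IsDDList D (G ++ pairGates (α := α) S n) ∧
      Layer (G ++ pairGates (α := α) S n) G.length (fun ν => (st ν, decide (x ∈ ν)))
        (d ∪ {x}) := by
  obtain ⟨hG', h'⟩ := hG.append_map (l := states (α × Bool))
    (g := fun p => .and [S + index p.1, n + if p.2 then 0 else 1])
    (s := fun p ν => (st ν, decide (x ∈ ν)) = p) (d := fun _ => d ∪ {x}) fun p _ => by
      have hlit : Computes G (n + if p.2 then 0 else 1) (fun ν => decide (x ∈ ν) = p.2) {x} := by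
        rcases p with ⟨a, _ | _⟩
        · exact hneg.imp (by simp) subset_rfl
        · exact hvar.imp (by simp) subset_rfl
      exact (Realizes.and_pair (h p.1) hlit (by have := hSn p.1; omega)
        (Set.disjoint_singleton_right.mpr hx)).imp (fun ν => by simp [Prod.ext_iff])
        subset_rfl
  exact ⟨hG', fun p => h' _ p (getElem?_states_index p)⟩

open Classical in
theorem Layer.read (hG : IsDDList D G) (h : Layer G S st d) {x : X} (hD : x ∈ D) (hx : x ∉ d)
    (δ : α → α) :
    IsDDList D (G ++ readGates S G.length x δ) ∧
      Layer (G ++ readGates S G.length x δ) (G.length + (Nat.card (α × Bool) + 2))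
        (fun ν => if x ∈ ν then δ (st ν) else st ν) (d ∪ {x}) := by
  have hvar : Realizes D G (.var x) (x ∈ ·) {x} := .var hD
  have hneg : Realizes D (G ++ [.var x]) (.neg G.length) (x ∉ ·) {x} := .neg hvar.computes
  have hlit := (hG.concat hvar.fits).concat hneg.fits
  have hprefix : G ++ [.var x] <+: G ++ [.var x] ++ [.neg G.length] := List.prefix_append _ _
  have hst : Layer (G ++ [.var x] ++ [.neg G.length]) S st d := fun a =>
    (h a).of_prefix ((List.prefix_append _ _).trans hprefix)
  obtain ⟨hpairG, hpair⟩ := hst.pair hlit hx (fun a => (h a).lt)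
    (hvar.computes.of_prefix hprefix) (by simpa using hneg.computes)
  have := hpair.map hpairG fun p : α × Bool => if p.2 then δ p.1 else p.1
  simpa [readGates, pairGates, length_states, add_assoc] using this

end Layer

/-- The gates that simulate a step on the last layer of a circuit with `n` gates. -/
noncomputable def Step.gates (n : ℕ) : Step α X → List (Gate X)
  | map g => mapGates (n - Nat.card α) g
  | read x δ => readGates (n - Nat.card α) n x δ

/-- The circuit `G`, whose last layer holds the state of an automaton, extended by the gates that
simulate the steps `w`. -/
noncomputable def simulate (G : List (Gate X)) (w : List (Step α X)) : List (Gate X) :=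
  w.foldl (fun G s => G ++ s.gates G.length) G

/-- The gates that, placed at position `n`, form a layer with the constant state `a`. -/
noncomputable def initialGates (n : ℕ) (a : α) : List (Gate X) :=
  .and [] :: mapGates n fun _ : Unit => a

theorem prefix_simulate (G : List (Gate X)) (w : List (Step α X)) : G <+: simulate G w := by
  induction w generalizing G with
  | nil => exact List.prefix_rfl
  | cons s w ih => exact (List.prefix_append _ _).trans (ih _)

section Simulate

variable {D d : Set X} {G : List (Gate X)} {st : Set X → α}

theorem Layer.step (hG : IsDDList D G) (h : Layer G (G.length - Nat.card α) st d) (s : Step α X)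
    (hD : ∀ x ∈ s.reads, x ∈ D) (hd : ∀ x ∈ s.reads, x ∉ d) :
    IsDDList D (G ++ s.gates G.length) ∧
      Layer (G ++ s.gates G.length) ((G ++ s.gates G.length).length - Nat.card α)
        (fun ν => s.run ν (st ν)) (d ∪ {x | x ∈ s.reads}) := by
  cases s with
  | map g => simpa [Step.gates, Step.reads, Step.run, length_mapGates] using h.map hG g
  | read x δ =>
    have hstart : (G ++ (Step.read x δ).gates G.length).length - Nat.card α =
        G.length + (Nat.card (α × Bool) + 2) := by
      rw [Step.gates, List.length_append, length_readGates]
      omega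
    rw [hstart]
    simpa [Step.reads, Step.run, Step.gates] using
      h.read hG (hD x (by simp [Step.reads])) (hd x (by simp [Step.reads])) δ

theorem Layer.simulate (hG : IsDDList D G) (h : Layer G (G.length - Nat.card α) st d)
    {w : List (Step α X)} (hw : (w.flatMap Step.reads).Nodup)
    (hD : ∀ x ∈ w.flatMap Step.reads, x ∈ D) (hd : ∀ x ∈ w.flatMap Step.reads, x ∉ d) :
    IsDDList D (simulate G w) ∧
      Layer (HQueries.simulate G w) ((HQueries.simulate G w).length - Nat.card α)
        (fun ν => Step.runAll ν (st ν) w) (d ∪ {x | x ∈ w.flatMap Step.reads}) := by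
  induction w generalizing G st d with
  | nil => simpa [HQueries.simulate, Step.runAll] using ⟨hG, h⟩
  | cons s w ih =>
    simp only [List.flatMap_cons, List.nodup_append, List.forall_mem_append] at hw hD hd
    obtain ⟨hG', h'⟩ := h.step hG s hD.1 hd.1
    have hd' : ∀ x ∈ w.flatMap Step.reads, x ∉ d ∪ {x | x ∈ s.reads} := fun x hx hxd =>
      hxd.elim (hd.2 x hx) fun hxs => hw.2.2 x hxs x hx rfl
    have hreads : d ∪ {x | x ∈ (s :: w).flatMap Step.reads} =
        d ∪ {x | x ∈ s.reads} ∪ {x | x ∈ w.flatMap Step.reads} := by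
      rw [Set.union_assoc, List.flatMap_cons]
      simp only [List.mem_append, Set.ofPred_or]
    rw [hreads]
    exact ih hG' h' hw.2.1 hD.2 hd'

theorem layer_initialGates (hG : IsDDList D G) (a : α) :
    IsDDList D (G ++ initialGates G.length a) ∧ Layer (G ++ initialGates G.length a)
      ((G ++ initialGates G.length a).length - Nat.card α) (fun _ => a) ∅ := by
  have htrue : Realizes D G (.and []) (fun _ => True) ∅ := .and_nil
  have hunit : Layer (G ++ [.and []]) G.length (fun _ => ()) ∅ := fun u => by
    have hu : index u = 0 := Nat.lt_one_iff.mp ((index_lt u).trans_eq Nat.card_unique)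
    simpa [hu] using htrue.computes
  have hstart : (G ++ initialGates G.length a).length - Nat.card α =
      (G ++ [Gate.and []]).length := by
    simp only [initialGates, List.length_append, List.length_cons, length_mapGates, List.length_nil]
    omega
  rw [hstart]
  simpa [initialGates] using hunit.map (hG.concat htrue.fits) fun _ => a

end Simulate

end Layers

/-! ### A language of commands for the machine -/

section Machine

/-- A bound on the number of steps of a program all of whose loops make at most `n` rounds, as a
polynomial in `n`. -/
noncomputable def Prog.cost : Prog → Polynomial ℕ
  | .seq p q => p.cost + q.cost
  | .ite _ p q => p.cost + q.cost + 1
  | .loop _ p => Polynomial.X * (p.cost + 1) + 1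
  | _ => 1

/-- Started in `σ`, the program `P` halts within `P.cost.eval n` steps in a configuration that
satisfies `Q`. -/
def Ensures (n : ℕ) (P : Prog) (σ : State) (Q : State → Prop) : Prop :=
  ∃ t τ, Exec P σ t τ ∧ t ≤ P.cost.eval n ∧ Q τ

/-- The configurations agree except for the registers from `X_r` on. -/
structure AgreeBelow (r : ℕ) (σ τ : State) : Prop where
  reg : ∀ x < r, τ.reg x = σ.reg x
  mem : τ.mem = σ.mem
  out : τ.out = σ.out

namespace AgreeBelow

variable {r r' : ℕ} {σ τ υ : State}

theorem rfl : AgreeBelow r σ σ := ⟨fun _ _ => Eq.refl _, Eq.refl _, Eq.refl _⟩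

theorem trans (h : AgreeBelow r σ τ) (h' : AgreeBelow r' τ υ) (hr : r ≤ r') : AgreeBelow r σ υ where
  reg x hx := (h'.reg x (hx.trans_le hr)).trans (h.reg x hx)
  mem := h'.mem.trans h.mem
  out := h'.out.trans h.out

theorem setReg (h : AgreeBelow r σ τ) {x : ℕ} (hx : r ≤ x) (v : ℕ) :
    AgreeBelow r σ (τ.setReg x v) where
  reg y hy := (Function.update_of_ne (hy.trans_le hx).ne _ _).trans (h.reg y hy)
  mem := h.mem
  out := h.out

theorem map_reg (h : AgreeBelow r σ τ) {ρ : List ℕ} (hρ : ∀ x ∈ ρ, x < r) :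
    ρ.map τ.reg = ρ.map σ.reg :=
  List.map_congr_left fun x hx => h.reg x (hρ x hx)

end AgreeBelow

theorem setReg_reg_self (σ : State) (r v : ℕ) : (σ.setReg r v).reg r = v :=
  Function.update_self _ _ _

theorem setReg_reg_of_ne (σ : State) {r x : ℕ} (h : x ≠ r) (v : ℕ) :
    (σ.setReg r v).reg x = σ.reg x :=
  Function.update_of_ne h _ _

namespace Ensures

variable {n r s t v : ℕ} {p q : Prog} {σ : State} {Q R : State → Prop}

theorem mono (h : Ensures n p σ R) (hQ : ∀ τ, R τ → Q τ) : Ensures n p σ Q := by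
  obtain ⟨t, τ, hexec, ht, hτ⟩ := h
  exact ⟨t, τ, hexec, ht, hQ τ hτ⟩

theorem const (h : Q (σ.setReg r v)) : Ensures n (.const r v) σ Q :=
  ⟨1, _, .const σ r v, by simp [Prog.cost], h⟩

theorem add (h : Q (σ.setReg r (σ.reg s + σ.reg t))) : Ensures n (.add r s t) σ Q :=
  ⟨1, _, .add σ r s t, by simp [Prog.cost], h⟩

theorem sub (h : Q (σ.setReg r (σ.reg s - σ.reg t))) : Ensures n (.sub r s t) σ Q :=
  ⟨1, _, .sub σ r s t, by simp [Prog.cost], h⟩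

theorem load (h : Q (σ.setReg r (σ.mem (σ.reg s)))) : Ensures n (.load r s) σ Q :=
  ⟨1, _, .load σ r s, by simp [Prog.cost], h⟩

theorem emit (h : Q { σ with out := σ.out ++ [σ.reg r] }) : Ensures n (.emit r) σ Q :=
  ⟨1, _, .emit σ r, by simp [Prog.cost], h⟩

theorem seq (hp : Ensures n p σ R) (hq : ∀ τ, R τ → Ensures n q τ Q) :
    Ensures n (.seq p q) σ Q := by
  obtain ⟨t, τ, hexec, ht, hτ⟩ := hp
  obtain ⟨t', υ, hexec', ht', hυ⟩ := hq τ hτ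
  exact ⟨t + t', υ, .seq hexec hexec', by simpa [Prog.cost] using add_le_add ht ht', hυ⟩

theorem ite (hp : σ.reg r ≠ 0 → Ensures n p σ Q) (hq : σ.reg r = 0 → Ensures n q σ Q) :
    Ensures n (.ite r p q) σ Q := by
  by_cases h : σ.reg r = 0
  · obtain ⟨t, τ, hexec, ht, hτ⟩ := hq h
    exact ⟨t + 1, τ, .ite_false h hexec, by simp [Prog.cost]; omega, hτ⟩
  · obtain ⟨t, τ, hexec, ht, hτ⟩ := hp h
    exact ⟨t + 1, τ, .ite_true h hexec, by simp [Prog.cost]; omega, hτ⟩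

theorem loop {I : ℕ → State → Prop} (hreg : ∀ i τ, I i τ → τ.reg r = i)
    (hbody : ∀ i τ, I (i + 1) τ → Ensures n p τ (I i)) {N : ℕ} (hN : N ≤ n) (h : I N σ) :
    Ensures n (.loop r p) σ (I 0) := by
  suffices ∃ t τ, Exec (.loop r p) σ t τ ∧ t ≤ N * (p.cost.eval n + 1) + 1 ∧ I 0 τ by
    obtain ⟨t, τ, hexec, ht, hτ⟩ := this
    refine ⟨t, τ, hexec, ht.trans ?_, hτ⟩
    simpa [Prog.cost] using hN
  clear hN
  induction N generalizing σ with
  | zero => exact ⟨1, σ, .loop_done (hreg 0 σ h), by simp, h⟩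
  | succ N ih =>
    obtain ⟨t, τ, hexec, ht, hτ⟩ := hbody N σ h
    obtain ⟨t', υ, hexec', ht', hυ⟩ := ih hτ
    refine ⟨t + t' + 1, υ, .loop_step (by rw [hreg _ σ h]; omega) hexec hexec', ?_, hυ⟩
    rw [Nat.succ_mul]
    omega

end Ensures

/-- Run `p` with `X_r = n - 1, …, 0`, where `n = M[0]`. -/
def countdown (r : ℕ) (p : Prog) : Prog :=
  .seq (.const r 0) <| .seq (.load r r) <| .loop r <|
    .seq (.const (r + 1) 1) <| .seq (.sub r r (r + 1)) p

theorem Ensures.countdown {r : ℕ} {p : Prog} {σ : State} {I : ℕ → State → Prop}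
    (hI : ∀ i τ υ, I i τ → AgreeBelow r τ υ → I i υ) (h : I (σ.mem 0) σ)
    (hbody : ∀ i τ, I (i + 1) τ → τ.reg r = i →
      Ensures (σ.mem 0) p τ fun υ => υ.reg r = i ∧ I i υ) :
    Ensures (σ.mem 0) (countdown r p) σ (I 0) := by
  have hround : ∀ i τ, τ.reg r = i + 1 ∧ I (i + 1) τ → Ensures (σ.mem 0)
      (.seq (.const (r + 1) 1) (.seq (.sub r r (r + 1)) p)) τ fun υ => υ.reg r = i ∧ I i υ := by
    rintro i τ ⟨hr, hτ⟩
    refine (const rfl).seq ?_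
    rintro _ rfl
    refine (sub rfl).seq ?_
    rintro _ rfl
    refine hbody i _ (hI _ τ _ hτ ((AgreeBelow.rfl.setReg (by omega) _).setReg le_rfl _)) ?_
    rw [setReg_reg_self, setReg_reg_self, setReg_reg_of_ne _ (by omega), hr, Nat.add_sub_cancel]
  refine (const rfl).seq ?_
  rintro _ rfl
  refine (load rfl).seq ?_
  rintro _ rfl
  refine (loop (I := fun i τ => τ.reg r = i ∧ I i τ) (fun _ _ h => h.1) hround le_rfl ⟨?_, ?_⟩).mono
    fun _ h => h.2
  · rw [setReg_reg_self, setReg_reg_self]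
    rfl
  · exact hI _ σ _ h ((AgreeBelow.rfl.setReg le_rfl _).setReg le_rfl _)

end Machine

section Language

/-- Arithmetic expressions over the number `pos` of gates written so far, local variables
(de Bruijn indices), and the memory; `sum e` adds up the values of `e` for the innermost variable
ranging over `0, …, M[0] - 1`. -/
inductive Exp : Type
  | pos : Exp
  | var (i : ℕ) : Exp
  | const (c : ℕ) : Exp
  | add (e f : Exp) : Exp
  | sub (e f : Exp) : Exp
  | load (e : Exp) : Exp
  | ite (e f g : Exp) : Exp
  | sum (e : Exp) : Exp

/-- The value of an expression, given the memory `M`, the number `p` of gates written so far and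
the values `s` of the local variables. -/
def Exp.eval (M : ℕ → ℕ) (p : ℕ) (s : List ℕ) : Exp → ℕ
  | .pos => p
  | .var i => s.getD i 0
  | .const c => c
  | .add e f => e.eval M p s + f.eval M p s
  | .sub e f => e.eval M p s - f.eval M p s
  | .load e => M (e.eval M p s)
  | .ite e f g => if e.eval M p s ≠ 0 then f.eval M p s else g.eval M p s
  | .sum e => ∑ j ∈ Finset.range (M 0), e.eval M p (j :: s)

/-- A program that writes the value of an expression to `X_r`.  The register `X₀` holds the number
of gates written so far, the registers listed in `ρ` hold the local variables, and the registers
from `X_r` on are scratch. -/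
def Exp.compile (ρ : List ℕ) (r : ℕ) : Exp → Prog
  | .pos => .seq (.const r 0) (.add r 0 r)
  | .var i => .seq (.const r 0) (match ρ[i]? with
    | some x => .add r x r
    | none => .const r 0)
  | .const c => .const r c
  | .add e f => .seq (.seq (e.compile ρ r) (f.compile ρ (r + 1))) (.add r r (r + 1))
  | .sub e f => .seq (.seq (e.compile ρ r) (f.compile ρ (r + 1))) (.sub r r (r + 1))
  | .load e => .seq (e.compile ρ r) (.load r r)
  | .ite e f g => .seq (e.compile ρ r) (.ite r (f.compile ρ r) (g.compile ρ r))
  | .sum e => .seq (.const r 0) <| countdown (r + 1) <|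
      .seq (e.compile ((r + 1) :: ρ) (r + 2)) (.add r r (r + 2))

/-- The outcome of running the compilation of an expression with value `v`. -/
def Exp.Computed (r : ℕ) (σ : State) (v : ℕ) (τ : State) : Prop :=
  τ.reg r = v ∧ AgreeBelow r σ τ

namespace Exp

variable {ρ : List ℕ} {r : ℕ} {e f : Exp} {σ τ : State}

theorem Computed.eval_eq (hρ : ∀ x ∈ ρ, x < r) (hr : 0 < r) {v : ℕ} (h : Computed r σ v τ)
    (e : Exp) : e.eval τ.mem (τ.reg 0) (ρ.map τ.reg) = e.eval σ.mem (σ.reg 0) (ρ.map σ.reg) := by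
  rw [h.2.mem, h.2.reg 0 hr, h.2.map_reg hρ]

/-- The specification of `Exp.compile`. -/
def CompilesCorrectly (e : Exp) : Prop :=
  ∀ ⦃ρ : List ℕ⦄ ⦃r : ℕ⦄, (∀ x ∈ ρ, x < r) → 0 < r → ∀ σ, Ensures (σ.mem 0) (e.compile ρ r) σ
    (Computed r σ (e.eval σ.mem (σ.reg 0) (ρ.map σ.reg)))

theorem CompilesCorrectly.pair (he : e.CompilesCorrectly) (hf : f.CompilesCorrectly)
    (hρ : ∀ x ∈ ρ, x < r) (hr : 0 < r) (σ : State) :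
    Ensures (σ.mem 0) (.seq (e.compile ρ r) (f.compile ρ (r + 1))) σ fun τ =>
      τ.reg r = e.eval σ.mem (σ.reg 0) (ρ.map σ.reg) ∧
        τ.reg (r + 1) = f.eval σ.mem (σ.reg 0) (ρ.map σ.reg) ∧ AgreeBelow r σ τ := by
  refine (he hρ hr σ).seq fun τ hτ => ?_
  have hf := hf (fun x hx => (hρ x hx).trans r.lt_succ_self) r.succ_pos τ
  rw [hτ.eval_eq hρ hr, hτ.2.mem] at hf
  exact hf.mono fun υ hυ =>
    ⟨(hυ.2.reg r r.lt_succ_self).trans hτ.1, hυ.1, hτ.2.trans hυ.2 r.le_succ⟩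

theorem Computed.setReg {v : ℕ} (h : AgreeBelow r σ τ) : Computed r σ v (τ.setReg r v) :=
  ⟨setReg_reg_self _ _ _, h.setReg le_rfl _⟩

theorem CompilesCorrectly.var (i : ℕ) : (var i).CompilesCorrectly := by
  intro ρ r hρ _ σ
  refine (Ensures.const rfl).seq ?_
  rintro _ rfl
  have hzero : AgreeBelow r σ (σ.setReg r 0) := AgreeBelow.rfl.setReg le_rfl 0
  rcases hx : ρ[i]? with _ | x
  · exact .const (by simpa [eval, hx] using Computed.setReg hzero)
  · refine .add ?_
    have hlt : x < r := hρ x (List.mem_of_getElem? hx)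
    rw [setReg_reg_of_ne _ hlt.ne, setReg_reg_self, add_zero]
    simpa [eval, hx] using Computed.setReg (v := σ.reg x) hzero

theorem CompilesCorrectly.ite {g : Exp} (he : e.CompilesCorrectly) (hf : f.CompilesCorrectly)
    (hg : g.CompilesCorrectly) : (ite e f g).CompilesCorrectly := by
  intro ρ r hρ hr σ
  refine (he hρ hr σ).seq fun τ hτ => ?_
  have hbranch {b : Exp} (hb : b.CompilesCorrectly) : Ensures (σ.mem 0) (b.compile ρ r) τ
      (Computed r σ (b.eval σ.mem (σ.reg 0) (ρ.map σ.reg))) := by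
    rw [← hτ.eval_eq hρ hr, ← hτ.2.mem]
    exact (hb hρ hr τ).mono fun υ hυ => ⟨hυ.1, hτ.2.trans hυ.2 le_rfl⟩
  refine .ite (fun h => ?_) fun h => ?_
  · rw [eval, if_pos (hτ.1 ▸ h)]
    exact hbranch hf
  · rw [eval, if_neg (not_not.mpr (hτ.1 ▸ h))]
    exact hbranch hg

theorem CompilesCorrectly.sum (he : e.CompilesCorrectly) : (sum e).CompilesCorrectly := by
  intro ρ r hρ hr σ
  let v (j : ℕ) : ℕ := e.eval σ.mem (σ.reg 0) (j :: ρ.map σ.reg)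
  let I (i : ℕ) (τ : State) : Prop :=
    τ.reg r + ∑ j ∈ Finset.range i, v j = ∑ j ∈ Finset.range (σ.mem 0), v j ∧ AgreeBelow r σ τ
  refine (Ensures.const rfl).seq ?_
  rintro _ rfl
  refine (Ensures.countdown (I := I) ?_ ?_ ?_).mono fun τ hτ =>
    ⟨by simpa [eval] using hτ.1, hτ.2⟩
  · rintro i τ υ ⟨hsum, hτ⟩ hυ
    exact ⟨by rw [hυ.reg r r.lt_succ_self, hsum], hτ.trans hυ r.le_succ⟩
  · exact ⟨by rw [setReg_reg_self, zero_add]; rfl, AgreeBelow.rfl.setReg le_rfl 0⟩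
  rintro i τ ⟨hsum, hτ⟩ hi
  have hbody := he (ρ := (r + 1) :: ρ) (r := r + 2)
    (by simpa using fun x hx => (hρ x hx).trans (by omega : r < r + 2)) (by omega) τ
  rw [List.map_cons, hi, hτ.map_reg hρ, hτ.reg 0 hr, hτ.mem] at hbody
  refine hbody.seq fun υ hυ => .add ⟨?_, ?_, ?_⟩
  · rw [setReg_reg_of_ne _ (by omega), hυ.2.reg _ (by omega), hi]
  · rw [setReg_reg_self, hυ.1, hυ.2.reg r (by omega), ← hsum, Finset.sum_range_succ]
    ring
  · exact (hτ.trans hυ.2 (by omega)).setReg le_rfl _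

theorem compilesCorrectly (e : Exp) : e.CompilesCorrectly := by
  induction e with
  | pos =>
    intro ρ r _ hr σ
    refine (Ensures.const rfl).seq ?_
    rintro _ rfl
    refine .add ?_
    rw [setReg_reg_of_ne _ hr.ne, setReg_reg_self, add_zero]
    exact .setReg (AgreeBelow.rfl.setReg le_rfl 0)
  | var i => exact .var i
  | const c => exact fun ρ r _ _ σ => .const (.setReg .rfl)
  | add e f he hf =>
    intro ρ r hρ hr σ
    refine (he.pair hf hρ hr σ).seq fun τ ⟨hre, hrf, hτ⟩ => .add ?_
    rw [hre, hrf]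
    exact .setReg hτ
  | sub e f he hf =>
    intro ρ r hρ hr σ
    refine (he.pair hf hρ hr σ).seq fun τ ⟨hre, hrf, hτ⟩ => .sub ?_
    rw [hre, hrf]
    exact .setReg hτ
  | load e he =>
    intro ρ r hρ hr σ
    refine (he hρ hr σ).seq fun τ ⟨hre, hτ⟩ => .load ?_
    rw [hre, hτ.mem]
    exact .setReg hτ
  | ite e f g he hf hg => exact he.ite hf hg
  | sum e he => exact he.sum

end Exp

/-- Commands that write a circuit: `print` writes a word, `tick` counts a finished gate, `bind`
evaluates an expression and pushes its value as a new innermost variable, and `forEach` runs its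
body for a new innermost variable with the values `M[0] - 1, …, 0`. -/
inductive Cmd : Type
  | skip : Cmd
  | print (e : Exp) : Cmd
  | tick : Cmd
  | seq (p q : Cmd) : Cmd
  | bind (e : Exp) (p : Cmd) : Cmd
  | ifZero (e : Exp) (p q : Cmd) : Cmd
  | forEach (p : Cmd) : Cmd

/-- The effect of a command on the pair of the number of gates and the words written so far. -/
def Cmd.run (M : ℕ → ℕ) (s : List ℕ) : Cmd → ℕ × List ℕ → ℕ × List ℕ
  | .skip, w => w
  | .print e, w => (w.1, w.2 ++ [e.eval M w.1 s])
  | .tick, w => (w.1 + 1, w.2)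
  | .seq p q, w => q.run M s (p.run M s w)
  | .bind e p, w => p.run M (e.eval M w.1 s :: s) w
  | .ifZero e p q, w => if e.eval M w.1 s = 0 then p.run M s w else q.run M s w
  | .forEach p, w => (List.range (M 0)).foldr (fun j => p.run M (j :: s)) w

/-- A program with the effect of a command, with the conventions of `Exp.compile`. -/
def Cmd.compile (ρ : List ℕ) (r : ℕ) : Cmd → Prog
  | .skip => .const r 0
  | .print e => .seq (e.compile ρ r) (.emit r)
  | .tick => .seq (.const r 1) (.add 0 0 r)
  | .seq p q => .seq (p.compile ρ r) (q.compile ρ r)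
  | .bind e p => .seq (e.compile ρ r) (p.compile (r :: ρ) (r + 1))
  | .ifZero e p q => .seq (e.compile ρ r) (.ite r (q.compile ρ r) (p.compile ρ r))
  | .forEach p => countdown r (p.compile (r :: ρ) (r + 1))

/-- The configuration `τ` records `w`, and agrees with `σ` on the memory and on the registers
between `X₀` and `X_r`. -/
structure Records (r : ℕ) (σ : State) (w : ℕ × List ℕ) (τ : State) : Prop where
  written : (τ.reg 0, τ.out) = w
  reg : ∀ x, 0 < x → x < r → τ.reg x = σ.reg x
  mem : τ.mem = σ.mem

theorem AgreeBelow.records {r : ℕ} {σ τ : State} (h : AgreeBelow r σ τ) (hr : 0 < r) :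
    Records r σ (σ.reg 0, σ.out) τ :=
  ⟨by rw [h.reg 0 hr, h.out], fun x _ hx => h.reg x hx, h.mem⟩

namespace Records

variable {r r' : ℕ} {σ τ υ : State} {w w' : ℕ × List ℕ} {ρ : List ℕ}

theorem trans (h : Records r σ w τ) (h' : Records r' τ w' υ) (hr : r ≤ r') : Records r σ w' υ where
  written := h'.written
  reg x h0 hx := (h'.reg x h0 (hx.trans_le hr)).trans (h.reg x h0 hx)
  mem := h'.mem.trans h.mem

theorem map_reg (h : Records r σ w τ) (hρ : ∀ x ∈ ρ, 0 < x ∧ x < r) : ρ.map τ.reg = ρ.map σ.reg :=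
  List.map_congr_left fun x hx => h.reg x (hρ x hx).1 (hρ x hx).2

end Records

namespace Cmd

variable {e : Exp} {p q : Cmd}

/-- The specification of `Cmd.compile`. -/
def CompilesCorrectly (p : Cmd) : Prop :=
  ∀ ⦃ρ : List ℕ⦄ ⦃r : ℕ⦄, (∀ x ∈ ρ, 0 < x ∧ x < r) → 0 < r → ∀ σ, Ensures (σ.mem 0)
    (p.compile ρ r) σ (Records r σ (p.run σ.mem (ρ.map σ.reg) (σ.reg 0, σ.out)))

theorem CompilesCorrectly.bind (hp : p.CompilesCorrectly) : (bind e p).CompilesCorrectly := by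
  intro ρ r hρ hr σ
  refine (e.compilesCorrectly (fun x hx => (hρ x hx).2) hr σ).seq fun τ ⟨hre, hτ⟩ => ?_
  have hp := hp (ρ := r :: ρ) (r := r + 1)
    (by simpa [hr] using fun x hx => (hρ x hx).imp_right (Nat.lt_succ_of_lt ·)) (by omega) τ
  rw [List.map_cons, hre, hτ.map_reg fun x hx => (hρ x hx).2, hτ.reg 0 hr, hτ.mem, hτ.out] at hp
  exact hp.mono fun υ hυ => (hτ.records hr).trans hυ r.le_succ

theorem CompilesCorrectly.ifZero (hp : p.CompilesCorrectly) (hq : q.CompilesCorrectly) :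
    (ifZero e p q).CompilesCorrectly := by
  intro ρ r hρ hr σ
  refine (e.compilesCorrectly (fun x hx => (hρ x hx).2) hr σ).seq fun τ ⟨hre, hτ⟩ => ?_
  have hτ' := hτ.records hr
  have hp := hp hρ hr τ
  have hq := hq hρ hr τ
  rw [hτ'.map_reg hρ, hτ'.written, hτ.mem] at hp hq
  refine .ite (fun h => ?_) fun h => ?_
  · rw [run, if_neg (hre ▸ h)]
    exact hq.mono fun υ hυ => hτ'.trans hυ le_rfl
  · rw [run, if_pos (hre ▸ h)]
    exact hp.mono fun υ hυ => hτ'.trans hυ le_rfl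

theorem CompilesCorrectly.forEach (hp : p.CompilesCorrectly) : (forEach p).CompilesCorrectly := by
  intro ρ r hρ hr σ
  let F (j : ℕ) : ℕ × List ℕ → ℕ × List ℕ := p.run σ.mem (j :: ρ.map σ.reg)
  let I (i : ℕ) (τ : State) : Prop := ∃ w, Records r σ w τ ∧
    (List.range i).foldr F w = (List.range (σ.mem 0)).foldr F (σ.reg 0, σ.out)
  refine (Ensures.countdown (I := I) ?_ ⟨_, AgreeBelow.rfl.records hr, rfl⟩ ?_).mono ?_
  · rintro i τ υ ⟨w, hτ, hw⟩ hυ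
    exact ⟨w, hτ.written ▸ hτ.trans (hυ.records hr) le_rfl, hw⟩
  · rintro i τ ⟨w, hτ, hw⟩ hi
    have hp := hp (ρ := r :: ρ) (r := r + 1)
      (by simpa [hr] using fun x hx => (hρ x hx).imp_right (Nat.lt_succ_of_lt ·)) (by omega) τ
    rw [List.map_cons, hi, hτ.map_reg hρ, hτ.written, hτ.mem] at hp
    refine hp.mono fun υ hυ =>
      ⟨(hυ.reg r hr r.lt_succ_self).trans hi, _, hτ.trans hυ r.le_succ, ?_⟩
    rw [← hw, List.range_succ, List.foldr_append]
    rfl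
  · rintro τ ⟨w, hτ, hw⟩
    rw [run, ← hw]
    exact hτ

theorem compilesCorrectly (p : Cmd) : p.CompilesCorrectly := by
  induction p with
  | skip => exact fun ρ r _ hr σ => .const ((AgreeBelow.rfl.setReg le_rfl 0).records hr)
  | print e =>
    intro ρ r hρ hr σ
    refine (e.compilesCorrectly (fun x hx => (hρ x hx).2) hr σ).seq fun τ ⟨hre, hτ⟩ => .emit ?_
    exact ⟨by simp [run, hre, hτ.out, hτ.reg 0 hr], fun x _ hx => hτ.reg x hx, hτ.mem⟩
  | tick =>
    intro ρ r _ hr σ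
    refine (Ensures.const rfl).seq ?_
    rintro _ rfl
    refine .add ?_
    rw [setReg_reg_self, setReg_reg_of_ne _ hr.ne]
    exact ⟨by rw [setReg_reg_self]; rfl, fun x h0 hx => by
      rw [setReg_reg_of_ne _ h0.ne', setReg_reg_of_ne _ hx.ne], rfl⟩
  | seq p q hp hq =>
    intro ρ r hρ hr σ
    refine (hp hρ hr σ).seq fun τ hτ => ?_
    have hq := hq hρ hr τ
    rw [hτ.written, hτ.map_reg hρ, hτ.mem] at hq
    exact hq.mono fun υ hυ => hτ.trans hυ le_rfl
  | bind e p hp => exact hp.bind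
  | ifZero e p q hp hq => exact hp.ifZero hq
  | forEach p hp => exact hp.forEach

end Cmd

end Language

/-! ### An automaton for the queries on one side of a query -/

section Queries

variable {k : ℕ}

/-- The number of the relation of a fact, where `R` and `T` have the numbers `0` and `k + 1`. -/
def DBFact.rel : DBFact k → Fin (k + 2)
  | .R _ => 0
  | .S i _ _ => ⟨i, by omega⟩
  | .T _ => Fin.last (k + 1)

/-- The constant that a fact assigns to the variable `x` of the queries `h_{k,i}`, or `0`. -/
def DBFact.xArg : DBFact k → ℕ
  | .R a => a
  | .S _ a _ => a
  | .T _ => 0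

/-- The constant that a fact assigns to the variable `y` of the queries `h_{k,i}`, or `0`. -/
def DBFact.yArg : DBFact k → ℕ
  | .R _ => 0
  | .S _ _ b => b
  | .T b => b

theorem R_mem_iff {Y : Set (DBFact k)} {a : ℕ} :
    DBFact.R a ∈ Y ↔ ∃ f ∈ Y, f.rel = 0 ∧ f.xArg = a := by
  refine ⟨fun h => ⟨_, h, rfl, rfl⟩, ?_⟩
  rintro ⟨_ | ⟨i, _, _⟩ | _, hf, hrel, rfl⟩
  · exact hf
  · have := congrArg Fin.val hrel
    simp only [DBFact.rel, Fin.val_zero] at this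
    omega
  · simp [DBFact.rel, Fin.ext_iff] at hrel

theorem T_mem_iff {Y : Set (DBFact k)} {b : ℕ} :
    DBFact.T b ∈ Y ↔ ∃ f ∈ Y, f.rel = Fin.last (k + 1) ∧ f.yArg = b := by
  refine ⟨fun h => ⟨_, h, rfl, rfl⟩, ?_⟩
  rintro ⟨_ | ⟨i, _, _⟩ | _, hf, hrel, rfl⟩
  · simp [DBFact.rel, Fin.ext_iff] at hrel
  · have := congrArg Fin.val hrel
    simp only [DBFact.rel, Fin.val_last] at this
    omega
  · exact hf

theorem holdsS_iff {Y : Set (DBFact k)} {i a b : ℕ} (h₁ : 1 ≤ i) (hk : i ≤ k) :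
    holdsS Y i a b ↔ ∃ f ∈ Y, (f.rel : ℕ) = i ∧ f.xArg = a ∧ f.yArg = b := by
  refine ⟨fun ⟨h, hf⟩ => ⟨_, hf, rfl, rfl, rfl⟩, ?_⟩
  rintro ⟨_ | ⟨i, _, _⟩ | _, hf, rfl, rfl, rfl⟩
  · simp [DBFact.rel] at h₁
  · exact ⟨⟨h₁, hk⟩, hf⟩
  · simp [DBFact.rel] at hk

/-- The two halves of the chain `h_{k,0}, …, h_{k,k}` of queries next to a missing one. The left
half is evaluated from `R` on, grouping the facts by `x` and then by `y`, and the right half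
symmetrically from `T` on, grouping the facts by `y` and then by `x`. -/
inductive Side : Type
  | left
  | right

namespace Side

/-- Numbers the relations, or the queries, from the given side on. -/
def reflect {n : ℕ} : Side → Fin n → Fin n
  | left, i => i
  | right, i => i.rev

theorem reflect_reflect {n : ℕ} (s : Side) (i : Fin n) : s.reflect (s.reflect i) = i := by
  cases s
  · rfl
  · exact i.rev_rev

/-- The constant by which the facts are grouped first. -/
def major : Side → DBFact k → ℕ
  | left, f => f.xArg
  | right, f => f.yArg

/-- The constant by which the facts of a group are split into cells. -/
def minor : Side → DBFact k → ℕ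
  | left, f => f.yArg
  | right, f => f.xArg

/-- The `i`-th query from the given side on, uniformly in `i`. The first one joins on the first
grouping constant only, since `R` and `T` are unary. -/
def Linked (s : Side) (i : Fin (k + 1)) (Y : Set (DBFact k)) : Prop :=
  ∃ f ∈ Y, ∃ g ∈ Y, s.reflect f.rel = i.castSucc ∧ s.reflect g.rel = i.succ ∧
    s.major f = s.major g ∧ (i ≠ 0 → s.minor f = s.minor g)

theorem Linked.mono {s : Side} {i : Fin (k + 1)} {Y Z : Set (DBFact k)} (h : s.Linked i Y)
    (hYZ : ∀ f ∈ Y, s.reflect f.rel ≤ i.succ → f ∈ Z) : s.Linked i Z := by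
  obtain ⟨f, hf, g, hg, hfi, hgi, heq⟩ := h
  exact ⟨f, hYZ f hf (hfi.trans_le i.castSucc_lt_succ.le), g, hYZ g hg hgi.le, hfi, hgi, heq⟩

theorem hQuery_iff_linked_left {i : Fin (k + 1)} (hi : (i : ℕ) < k) (Y : Set (DBFact k)) :
    hQuery k i Y ↔ left.Linked i Y := by
  unfold hQuery Linked
  split_ifs with h0
  · obtain rfl : i = 0 := Fin.ext h0
    simp only [R_mem_iff, holdsS_iff le_rfl (by omega : 1 ≤ k), reflect, major, Fin.ext_iff]
    constructor
    · rintro ⟨x, y, ⟨f, hf, hfr, rfl⟩, g, hg, hgr, hgx, rfl⟩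
      exact ⟨f, hf, g, hg, by simpa using hfr, by simpa using hgr, hgx.symm, by simp⟩
    · rintro ⟨f, hf, g, hg, hfr, hgr, hx, -⟩
      exact ⟨_, _, ⟨f, hf, by simpa using hfr, rfl⟩, g, hg, by simpa using hgr, hx.symm, rfl⟩
  · simp only [holdsS_iff (by omega : 1 ≤ (i : ℕ)) hi.le,
      holdsS_iff (by omega : 1 ≤ (i : ℕ) + 1) (by omega : (i : ℕ) + 1 ≤ k), reflect, major, minor,
      Fin.ext_iff]
    constructor
    · rintro ⟨x, y, ⟨f, hf, hfr, rfl, rfl⟩, g, hg, hgr, hgx, hgy⟩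
      exact ⟨f, hf, g, hg, by simpa using hfr, by simpa using hgr, hgx.symm, fun _ => hgy.symm⟩
    · rintro ⟨f, hf, g, hg, hfr, hgr, hx, hy⟩
      exact ⟨_, _, ⟨f, hf, by simpa using hfr, rfl, rfl⟩, g, hg, by simpa using hgr, hx.symm,
        (hy (by simpa using h0)).symm⟩

theorem hQuery_rev_iff_linked_right {i : Fin (k + 1)} (hi : (i : ℕ) < k) (Y : Set (DBFact k)) :
    hQuery k i.rev Y ↔ right.Linked i Y := by
  have hpos : (i.rev : ℕ) ≠ 0 := by rw [Fin.val_rev]; omega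
  have hsucc : (i.rev : ℕ) = i.succ.rev := by simp [Fin.val_rev]
  unfold hQuery Linked
  rw [if_neg hpos]
  simp only [reflect, major, minor, Fin.rev_eq_iff]
  split_ifs with hlt
  · have h0 : (i : ℕ) ≠ 0 := fun h => by simp [Fin.val_rev, h] at hlt
    have hcast : (i.rev : ℕ) + 1 = i.castSucc.rev := by simp [Fin.val_rev]; omega
    rw [hcast]
    simp only [holdsS_iff (by omega : 1 ≤ (i.rev : ℕ)) hlt.le,
      holdsS_iff (by omega : 1 ≤ (i.castSucc.rev : ℕ)) (by omega : (i.castSucc.rev : ℕ) ≤ k)]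
    constructor
    · rintro ⟨x, y, ⟨g, hg, hgr, rfl, rfl⟩, f, hf, hfr, hfx, hfy⟩
      exact ⟨f, hf, g, hg, Fin.ext hfr, Fin.ext (hgr.trans hsucc), hfy, fun _ => hfx⟩
    · rintro ⟨f, hf, g, hg, hfr, hgr, hy, hx⟩
      exact ⟨_, _, ⟨g, hg, by rw [hgr, hsucc], rfl, rfl⟩, f, hf, by rw [hfr],
        hx fun h => h0 (congrArg Fin.val h), hy⟩
  · obtain rfl : i = 0 := Fin.ext (by rw [Fin.val_rev] at hlt; rw [Fin.val_zero]; omega)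
    simp only [T_mem_iff, holdsS_iff hi le_rfl]
    constructor
    · rintro ⟨x, y, ⟨g, hg, hgr, rfl, rfl⟩, f, hf, hfr, hfy⟩
      exact ⟨f, hf, g, hg, by simpa using hfr, Fin.ext (by simpa using hgr), hfy, by simp⟩
    · rintro ⟨f, hf, g, hg, hfr, hgr, hy, -⟩
      exact ⟨_, _, ⟨g, hg, by simp [hgr], rfl, rfl⟩, f, hf, by simpa using hfr, hy⟩

theorem hQuery_reflect_iff_linked (s : Side) {i : Fin (k + 1)} (hi : (i : ℕ) < k)
    (Y : Set (DBFact k)) : hQuery k (s.reflect i) Y ↔ s.Linked i Y := by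
  cases s
  · exact hQuery_iff_linked_left hi Y
  · exact hQuery_rev_iff_linked_right hi Y

end Side

end Queries

section Automaton

variable {k : ℕ}

/-- A state of the automaton that evaluates the queries from one side on: the set `link` of queries
already found to hold, and the sets `group` and `cell` of relations that have a fact in the current
group and in the current cell. -/
@[ext]
structure Memory (k : ℕ) : Type where
  link : Set (Fin (k + 1))
  group : Set (Fin (k + 2))
  cell : Set (Fin (k + 2))

instance : Finite (Memory k) :=
  Finite.of_injective (fun m : Memory k => (m.link, m.group, m.cell)) fun m m' h => by
    simpa [Memory.ext_iff] using h

namespace Memory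

/-- The relations of the facts seen so far that can be joined with a new fact in the `i`-th
query. -/
def mates (m : Memory k) (i : Fin (k + 1)) : Set (Fin (k + 2)) := if i = 0 then m.group else m.cell

/-- The state after reading a fact whose relation has the number `a`. -/
def read (a : Fin (k + 2)) (m : Memory k) : Memory k where
  link := m.link ∪ {i | a = i.castSucc ∧ i.succ ∈ m.mates i ∨ a = i.succ ∧ i.castSucc ∈ m.mates i}
  group := insert a m.group
  cell := insert a m.cell

/-- The state after leaving a cell. -/
def clearCell (m : Memory k) : Memory k := { m with cell := ∅ }

/-- The state after leaving a group. -/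
def clearGroup (m : Memory k) : Memory k := { m with group := ∅ }

end Memory

namespace Side

variable (s : Side)

/-- The state after reading the facts in `Y`, in the group with the constant `u` and the cell with
the constant `v`; the value `none` stands for being between two groups or cells. -/
def memory (u v : Option ℕ) (Y : Set (DBFact k)) : Memory k where
  link := {i | s.Linked i Y}
  group := {a | ∃ f ∈ Y, s.reflect f.rel = a ∧ some (s.major f) = u}
  cell := {a | ∃ f ∈ Y, s.reflect f.rel = a ∧ some (s.major f) = u ∧ some (s.minor f) = v}

variable {s} {u v : Option ℕ} {Y : Set (DBFact k)}

theorem memory_empty (u v : Option ℕ) : s.memory u v (∅ : Set (DBFact k)) = ⟨∅, ∅, ∅⟩ := by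
  simp [memory, Linked]

theorem clearCell_memory : (s.memory u v Y).clearCell = s.memory u none Y := by
  simp [Memory.clearCell, memory]

theorem clearGroup_memory : (s.memory u none Y).clearGroup = s.memory none none Y := by
  simp [Memory.clearGroup, memory]

theorem memory_enter_group (h : ∀ f ∈ Y, some (s.major f) ≠ u) :
    s.memory none none Y = s.memory u none Y := by
  simpa [memory, Set.ext_iff] using fun a f hf _ => h f hf

theorem memory_enter_cell (h : ∀ f ∈ Y, some (s.major f) = u → some (s.minor f) ≠ v) :
    s.memory u none Y = s.memory u v Y := by
  simpa [memory, Set.ext_iff] using fun a f hf _ => h f hf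

theorem mem_mates_memory {f : DBFact k} {i : Fin (k + 1)} {a : Fin (k + 2)} :
    a ∈ (s.memory (some (s.major f)) (some (s.minor f)) Y).mates i ↔
      ∃ g ∈ Y, s.reflect g.rel = a ∧ s.major f = s.major g ∧ (i ≠ 0 → s.minor f = s.minor g) := by
  by_cases h : i = 0 <;> simp [Memory.mates, memory, h, eq_comm]

theorem linked_insert {f : DBFact k} {i : Fin (k + 1)} :
    s.Linked i (insert f Y) ↔ s.Linked i Y ∨
      (s.reflect f.rel = i.castSucc ∧ i.succ ∈ (s.memory (s.major f) (s.minor f) Y).mates i ∨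
        s.reflect f.rel = i.succ ∧ i.castSucc ∈ (s.memory (s.major f) (s.minor f) Y).mates i) := by
  simp only [mem_mates_memory]
  constructor
  · rintro ⟨g, rfl | hg, g', rfl | hg', hi, hi', hu, hv⟩
    · exact absurd (hi.symm.trans hi') i.castSucc_lt_succ.ne
    · exact .inr (.inl ⟨hi, g', hg', hi', hu, hv⟩)
    · exact .inr (.inr ⟨hi', g, hg, hi, hu.symm, fun h => (hv h).symm⟩)
    · exact .inl ⟨g, hg, g', hg', hi, hi', hu, hv⟩
  · rintro (h | ⟨hi, g, hg, hi', hu, hv⟩ | ⟨hi', g, hg, hi, hu, hv⟩)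
    · exact h.mono fun g hg _ => .inr hg
    · exact ⟨f, .inl rfl, g, .inr hg, hi, hi', hu, hv⟩
    · exact ⟨g, .inr hg, f, .inl rfl, hi, hi', hu.symm, fun h => (hv h).symm⟩

theorem read_memory (f : DBFact k) : (s.memory (s.major f) (s.minor f) Y).read (s.reflect f.rel) =
    s.memory (s.major f) (s.minor f) (insert f Y) := by
  ext i
  · exact linked_insert.symm
  · simp [Memory.read, memory, eq_comm]
  · simp [Memory.read, memory, eq_comm]

variable (s) in
/-- The facts that are relevant for the queries before `l` from the given side on. -/
def Relevant (l : Fin (k + 1)) (f : DBFact k) : Prop := s.reflect f.rel ≤ (s.reflect l).castSucc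

instance (l : Fin (k + 1)) : DecidablePred (s.Relevant l) := fun _ =>
  inferInstanceAs (Decidable (_ ≤ _))

variable (s) in
/-- The step of the automaton that reads the fact `f`. -/
def readStep (f : DBFact k) : Step (Memory k) (DBFact k) := .read f (Memory.read (s.reflect f.rel))

variable (s) in
/-- The steps for the cell with the grouping constants `u` and `v`. -/
def cellScript (l : Fin (k + 1)) (K : List (DBFact k)) (u v : ℕ) :
    List (Step (Memory k) (DBFact k)) :=
  (K.filter fun f => s.major f = u ∧ s.minor f = v ∧ s.Relevant l f).map s.readStep ++
    [.map Memory.clearCell]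

variable (s) in
/-- The steps for the group with the constant `u`. -/
def groupScript (l : Fin (k + 1)) (K : List (DBFact k)) (u : ℕ) :
    List (Step (Memory k) (DBFact k)) :=
  ((K.map s.minor).dedup.flatMap (s.cellScript l K u)) ++ [.map Memory.clearGroup]

variable (s) in
/-- The steps of the automaton on the facts listed in `K` that are relevant for the queries
before `l`. -/
def script (l : Fin (k + 1)) (K : List (DBFact k)) : List (Step (Memory k) (DBFact k)) :=
  (K.map s.major).dedup.flatMap (s.groupScript l K)

section Script

open Step (runAll runAll_append)

variable {l : Fin (k + 1)} {K : List (DBFact k)} {ν : Set (DBFact k)}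

theorem run_readStep (f : DBFact k) : (s.readStep f).run ν (s.memory (s.major f) (s.minor f) Y) =
    s.memory (s.major f) (s.minor f) (Y ∪ {f} ∩ ν) := by
  by_cases hf : f ∈ ν
  · rw [Set.inter_eq_left.mpr (Set.singleton_subset_iff.mpr hf), Set.union_singleton, ← read_memory]
    exact if_pos hf
  · rw [Set.singleton_inter_eq_empty.mpr hf, Set.union_empty]
    exact if_neg hf

theorem runAll_readStep {F : List (DBFact k)} {u v : ℕ}
    (hF : ∀ f ∈ F, s.major f = u ∧ s.minor f = v) :
    runAll ν (s.memory u v Y) (F.map s.readStep) = s.memory u v (Y ∪ {f | f ∈ F} ∩ ν) := by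
  induction F generalizing Y with
  | nil => simp [runAll]
  | cons f F ih =>
    obtain ⟨⟨rfl, rfl⟩, hF⟩ := List.forall_mem_cons.mp hF
    rw [List.map_cons, runAll, List.foldl_cons, run_readStep]
    refine (ih hF).trans (congrArg _ ?_)
    ext g
    simp
    tauto

theorem runAll_cellScript {u v : ℕ} (hY : ∀ f ∈ Y, s.major f = u → s.minor f ≠ v) :
    runAll ν (s.memory u none Y) (s.cellScript l K u v) = s.memory u none
      (Y ∪ {f | (f ∈ K ∧ s.Relevant l f ∧ s.major f = u) ∧ s.minor f = v} ∩ ν) := by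
  rw [memory_enter_cell (v := some v) (by simpa using hY), cellScript, runAll_append,
    runAll_readStep (by simp +contextual)]
  refine clearCell_memory.trans (congrArg _ ?_)
  ext f
  simp
  tauto

theorem runAll_flatMap {α X : Type*} {m : Set X → α} {key : X → ℕ} {w : ℕ → List (Step α X)}
    {C P ν : Set X} {V : List ℕ} (hV : V.Nodup)
    (hw : ∀ v Y, (∀ f ∈ Y, f ∈ C → key f ≠ v) →
      runAll ν (m Y) (w v) = m (Y ∪ {f | f ∈ P ∧ key f = v} ∩ ν))
    {Y : Set X} (hY : ∀ f ∈ Y, f ∈ C → key f ∉ V) :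
    runAll ν (m Y) (V.flatMap w) = m (Y ∪ {f | f ∈ P ∧ key f ∈ V} ∩ ν) := by
  induction V generalizing Y with
  | nil => simp [runAll]
  | cons v V ih =>
    obtain ⟨hv, hV⟩ := List.nodup_cons.mp hV
    rw [List.flatMap_cons, runAll_append, hw v Y fun f hf hC => ?_, ih hV]
    · congr 1
      ext f
      simp
      tauto
    · rintro f (hf | ⟨⟨-, rfl⟩, -⟩) hC
      · exact fun h => hY f hf hC (List.mem_cons_of_mem v h)
      · exact hv
    · rintro rfl
      exact hY f hf hC List.mem_cons_self

theorem runAll_groupScript {u : ℕ} (hY : ∀ f ∈ Y, s.major f ≠ u) :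
    runAll ν (s.memory none none Y) (s.groupScript l K u) = s.memory none none
      (Y ∪ {f | (f ∈ K ∧ s.Relevant l f) ∧ s.major f = u} ∩ ν) := by
  rw [memory_enter_group (u := some u) (by simpa using hY), groupScript, runAll_append,
    runAll_flatMap (P := {f | f ∈ K ∧ s.Relevant l f ∧ s.major f = u}) (K.map s.minor).nodup_dedup
      (fun _ _ => runAll_cellScript) fun f hf hu => absurd hu (hY f hf)]
  refine clearGroup_memory.trans (congrArg _ ?_)
  ext f
  simp
  tauto

theorem runAll_script : runAll ν (⟨∅, ∅, ∅⟩ : Memory k) (s.script l K) =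
    s.memory none none {f | (f ∈ K ∧ s.Relevant l f) ∧ f ∈ ν} := by
  rw [← memory_empty (s := s) none none, script, runAll_flatMap (C := Set.univ)
    (P := {f | f ∈ K ∧ s.Relevant l f}) (K.map s.major).nodup_dedup
    (fun _ _ h => runAll_groupScript fun f hf => h f hf trivial) (by simp)]
  congr 1
  ext f
  simp
  tauto

theorem flatMap_reads_script : (s.script l K).flatMap Step.reads =
    (K.map s.major).dedup.flatMap fun u => (K.map s.minor).dedup.flatMap fun v =>
      K.filter fun f => s.major f = u ∧ s.minor f = v ∧ s.Relevant l f := by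
  simp [script, groupScript, cellScript, readStep, Step.reads, List.flatMap_assoc,
    List.flatMap_append, List.flatMap_map]

theorem mem_flatMap_reads_script {f : DBFact k} :
    f ∈ (s.script l K).flatMap Step.reads ↔ f ∈ K ∧ s.Relevant l f := by
  simp only [flatMap_reads_script, List.mem_flatMap, List.mem_dedup, List.mem_map, List.mem_filter,
    decide_eq_true_eq]
  exact ⟨fun ⟨_, _, _, _, hf, _, _, hl⟩ => ⟨hf, hl⟩,
    fun ⟨hf, hl⟩ => ⟨_, ⟨f, hf, rfl⟩, _, ⟨f, hf, rfl⟩, hf, rfl, rfl, hl⟩⟩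

theorem nodup_flatMap_reads_script (hK : K.Nodup) :
    ((s.script l K).flatMap Step.reads).Nodup := by
  rw [flatMap_reads_script]
  refine List.nodup_flatMap.mpr ⟨fun u _ => List.nodup_flatMap.mpr ⟨fun v _ => hK.filter _, ?_⟩, ?_⟩
  · refine (K.map s.minor).nodup_dedup.imp fun {v v'} hne f hf hf' => hne ?_
    simp only [List.mem_filter, decide_eq_true_eq] at hf hf'
    exact hf.2.2.1.symm.trans hf'.2.2.1
  · refine (K.map s.major).nodup_dedup.imp fun {u u'} hne f hf hf' => hne ?_
    simp only [List.mem_flatMap, List.mem_filter, decide_eq_true_eq] at hf hf'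
    obtain ⟨_, -, -, hu, -⟩ := hf
    obtain ⟨_, -, -, hu', -⟩ := hf'
    exact hu.symm.trans hu'

end Script

variable (s) in
/-- The queries before `l` from the given side on that hold are those in `N`. -/
def Matches (l : Fin (k + 1)) (N : Finset (Fin (k + 1))) (m : Memory k) : Prop :=
  ∀ i, i < s.reflect l → (i ∈ m.link ↔ s.reflect i ∈ N)

end Side

open Classical in
/-- The set of queries `h_{k,i}` that hold in `Y`. -/
noncomputable def heldQueries (Y : Set (DBFact k)) : Finset (Fin (k + 1)) :=
  Finset.univ.filter fun i => hQuery k i Y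

theorem mem_heldQueries {Y : Set (DBFact k)} {i : Fin (k + 1)} :
    i ∈ heldQueries Y ↔ hQuery k i Y := by
  simp [heldQueries]

namespace Side

variable {s : Side}

theorem matches_memory_iff {l : Fin (k + 1)} {N : Finset (Fin (k + 1))} {Y : Set (DBFact k)} :
    s.Matches l N (s.memory none none {f | f ∈ Y ∧ s.Relevant l f}) ↔
      ∀ i, s.reflect i < s.reflect l → (i ∈ heldQueries Y ↔ i ∈ N) := by
  have hlinked (i : Fin (k + 1)) (hi : i < s.reflect l) :
      s.Linked i {f | f ∈ Y ∧ s.Relevant l f} ↔ s.reflect i ∈ heldQueries Y := by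
    rw [mem_heldQueries, s.hQuery_reflect_iff_linked (by omega)]
    refine ⟨fun h => h.mono fun f hf _ => hf.1, fun h => h.mono fun f hf hle => ⟨hf, ?_⟩⟩
    exact hle.trans (Fin.succ_le_castSucc_iff.mpr hi)
  refine ⟨fun h i hi => ?_, fun h i hi => ?_⟩
  · have := h _ hi
    rwa [memory, Set.mem_ofPred_eq, hlinked _ hi, reflect_reflect] at this
  · rw [memory, Set.mem_ofPred_eq, hlinked i hi]
    exact h _ (by rwa [reflect_reflect])

theorem disjoint_relevant (l : Fin (k + 1)) :
    Disjoint {f : DBFact k | left.Relevant l f} {f | right.Relevant l f} := by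
  refine Set.disjoint_left.mpr fun f hleft hright => ?_
  simp only [Relevant, reflect, Fin.le_def, Fin.val_castSucc, Fin.val_rev, Set.mem_ofPred_eq]
    at hleft hright
  omega

theorem reflect_lt_reflect_iff_ne {i l : Fin (k + 1)} :
    left.reflect i < left.reflect l ∨ right.reflect i < right.reflect l ↔ i ≠ l := by
  rw [reflect, reflect, reflect, reflect, Fin.rev_lt_rev, lt_or_lt_iff_ne]

end Side

end Automaton

/-! ### Writing gates -/

section Writing

variable {k : ℕ} {M : ℕ → ℕ} {p : ℕ} {s : List ℕ} {G : List (Gate (DBFact k))}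

/-- The number of gates and the words written when the gates `G` have been written. -/
def tape (G : List (Gate (DBFact k))) : ℕ × List ℕ := (G.length, G.flatMap Gate.code)

/-- Writes a gate, given by its words. -/
def writeGate (words : List Exp) : Cmd := words.foldr (fun e c => .seq (.print e) c) .tick

/-- Writes a list of gates, each of them given by its words. -/
def writeGates (gates : List (List Exp)) : Cmd :=
  gates.foldr (fun words c => .seq (writeGate words) c) .skip

theorem run_writeGate (words : List Exp) (w : ℕ × List ℕ) :
    (writeGate words).run M s w = (w.1 + 1, w.2 ++ words.map (Exp.eval M w.1 s)) := by
  induction words generalizing w with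
  | nil => simp [writeGate, Cmd.run]
  | cons e words ih => exact (ih _).trans (by simp [Cmd.run])

theorem run_writeGate_tape {words : List Exp} {g : Gate (DBFact k)}
    (h : words.map (Exp.eval M G.length s) = g.code) :
    (writeGate words).run M s (tape G) = tape (G ++ [g]) := by
  simp [run_writeGate, tape, h]

theorem run_writeGates {words : List (List Exp)} {gates : List (Gate (DBFact k))}
    (h : ∀ p, words.map (List.map (Exp.eval M p s)) = gates.map Gate.code) :
    (writeGates words).run M s (tape G) = tape (G ++ gates) := by
  induction words generalizing gates G with
  | nil =>
    obtain rfl : gates = [] := by simpa using (h 0).symm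
    simp [writeGates, Cmd.run]
  | cons head words ih =>
    obtain ⟨g, gates, rfl⟩ : ∃ g gates', gates = g :: gates' :=
      List.exists_cons_of_ne_nil fun hnil => by simpa [hnil] using h 0
    have hword (p) := List.cons_eq_cons.mp (h p)
    rw [List.append_cons, ← ih fun p => (hword p).2]
    exact congrArg _ (run_writeGate_tape (hword _).1)

/-- The words of an `∧`-gate with the given inputs. -/
def andWords (J : List Exp) : List Exp := .const 2 :: .const J.length :: J

/-- The words of an `∨`-gate with the given inputs. -/
def orWords (J : List Exp) : List Exp := .const 3 :: .const J.length :: J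

theorem map_andWords (J : List Exp) : (andWords J).map (Exp.eval M p s) =
    (Gate.and (J.map (Exp.eval M p s)) : Gate (DBFact k)).code := by
  simp [andWords, Gate.code, Exp.eval]

theorem map_orWords (J : List Exp) : (orWords J).map (Exp.eval M p s) =
    (Gate.or (J.map (Exp.eval M p s)) : Gate (DBFact k)).code := by
  simp [orWords, Gate.code, Exp.eval]

/-- The value of the innermost variable plus `c`; this variable usually holds the number of gates
at the beginning of a step. -/
def newRef (c : ℕ) : Exp := .add (.var 0) (.const c)

/-- The value of the innermost variable minus `m` plus `c`. -/
def oldRef (m c : ℕ) : Exp := .add (.sub (.var 0) (.const m)) (.const c)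

section Layers

variable {α β : Type*} [Finite α] [Finite β] {S : ℕ} {base : ℕ → Exp}

open Classical in
/-- The words of `acceptGate`, where `base c` refers to the gate number `c` of the layer. -/
noncomputable def acceptWords (base : ℕ → Exp) (P : α → Prop) : List Exp :=
  orWords (((states α).filter (P ·)).map fun a => base (index a))

/-- The words of `mapGates`, where `base c` refers to the gate number `c` of the layer. -/
noncomputable def mapWords (base : ℕ → Exp) (g : α → β) : List (List Exp) :=
  (states β).map fun b => acceptWords base fun a => g a = b

variable (α) in
/-- The words of `pairGates`, where `base c` refers to the gate number `c` of the layer. -/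
noncomputable def pairWords (base : ℕ → Exp) : List (List Exp) :=
  (states (α × Bool)).map fun a => andWords [base (index a.1), newRef (if a.2 then 0 else 1)]

theorem map_acceptWords (h : ∀ c, (base c).eval M p s = S + c) (P : α → Prop) :
    (acceptWords base P).map (Exp.eval M p s) = (acceptGate S P : Gate (DBFact k)).code := by
  simp [acceptWords, map_orWords (k := k), acceptGate, Function.comp_def, h]

theorem map_mapWords (h : ∀ c, (base c).eval M p s = S + c) (g : α → β) :
    (mapWords base g).map (List.map (Exp.eval M p s)) =
      (mapGates S g : List (Gate (DBFact k))).map Gate.code := by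
  simp [mapWords, mapGates, map_acceptWords (k := k) h]

theorem map_pairWords {n : ℕ} (h : ∀ c, (base c).eval M p (n :: s) = S + c) :
    (pairWords α base).map (List.map (Exp.eval M p (n :: s))) =
      (pairGates (α := α) S n : List (Gate (DBFact k))).map Gate.code := by
  simp [pairWords, pairGates, map_andWords (k := k), newRef, Exp.eval, h, apply_ite]

end Layers

end Writing

/-! ### Facts in the input -/

section Facts

variable {k : ℕ} {L : List (DBFact k)} {p i : ℕ} {s : List ℕ} {f g : DBFact k}

/-- The variable `i` holds the position of the fact `f` in the list `L`. -/
def Points (L : List (DBFact k)) (s : List ℕ) (i : ℕ) (f : DBFact k) : Prop :=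
  ∃ j, s[i]? = some j ∧ L[j]? = some f

theorem Points.shift (h : Points L s i f) (j : ℕ) : Points L (j :: s) (i + 1) f := h

/-- The `c`-th word of the code of the fact to which the variable `i` points; the facts start at
the memory cell `1` and take three words each. -/
def Exp.word (i c : ℕ) : Exp :=
  .load (.add (.add (.var i) (.add (.var i) (.var i))) (.const (c + 1)))

theorem length_code (f : DBFact k) : f.code.length = 3 := by cases f <;> rfl

theorem getD_flatMap_code {j c : ℕ} (hf : L[j]? = some f) (hc : c < 3) :
    (L.flatMap DBFact.code).getD (j + (j + j) + c) 0 = f.code.getD c 0 := by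
  induction L generalizing j with
  | nil => simp at hf
  | cons g L ih =>
    rw [List.flatMap_cons]
    rcases j with _ | j
    · obtain rfl : g = f := by simpa using hf
      rw [List.getD_append _ _ _ _ (by rw [length_code]; omega)]
      simp
    · rw [List.getD_append_right _ _ _ _ (by rw [length_code]; omega), length_code,
        ← ih (by simpa using hf)]
      congr 1
      omega

theorem eval_word (h : Points L s i f) {c : ℕ} (hc : c < 3) :
    (Exp.word i c).eval (inputState L).mem p s = f.code.getD c 0 := by
  obtain ⟨j, hj, hf⟩ := h
  rw [← getD_flatMap_code hf hc]
  simp [Exp.word, Exp.eval, inputState, hj, ← add_assoc]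

/-- The number of the relation of the fact to which the variable `i` points. -/
def Exp.rel (i : ℕ) : Exp := .word i 0

variable (k) in
/-- The number `DBFact.xArg` of the fact to which the variable `i` points. -/
def Exp.xArg (i : ℕ) : Exp := .ite (.sub (.const (k + 1)) (.rel i)) (.word i 1) (.word i 2)

variable (k) in
/-- The number `DBFact.yArg` of the fact to which the variable `i` points. -/
def Exp.yArg (i : ℕ) : Exp := .ite (.sub (.const (k + 1)) (.rel i)) (.word i 2) (.word i 1)

theorem eval_rel (h : Points L s i f) : (Exp.rel i).eval (inputState L).mem p s = f.rel := by
  rw [Exp.rel, eval_word h (by omega)]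
  cases f <;> rfl

theorem eval_xArg (h : Points L s i f) :
    (Exp.xArg k i).eval (inputState L).mem p s = f.xArg := by
  simp only [Exp.xArg, Exp.eval, eval_rel h, eval_word h (by omega : 1 < 3),
    eval_word h (by omega : 2 < 3)]
  cases f with
  | R a => simp [DBFact.rel, DBFact.code, DBFact.xArg]
  | S i a b => simp [DBFact.rel, DBFact.code, DBFact.xArg]; omega
  | T b => simp [DBFact.rel, DBFact.code, DBFact.xArg]

theorem eval_yArg (h : Points L s i f) :
    (Exp.yArg k i).eval (inputState L).mem p s = f.yArg := by
  simp only [Exp.yArg, Exp.eval, eval_rel h, eval_word h (by omega : 1 < 3),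
    eval_word h (by omega : 2 < 3)]
  cases f with
  | R a => simp [DBFact.rel, DBFact.code, DBFact.yArg]
  | S i a b => simp [DBFact.rel, DBFact.code, DBFact.yArg]; omega
  | T b => simp [DBFact.rel, DBFact.code, DBFact.yArg]

/-- An expression that is zero if and only if `e` and `f` have the same value. -/
def Exp.dist (e f : Exp) : Exp := .add (.sub e f) (.sub f e)

theorem eval_dist_eq_zero_iff {M : ℕ → ℕ} {e f : Exp} :
    (e.dist f).eval M p s = 0 ↔ e.eval M p s = f.eval M p s := by
  simp only [Exp.dist, Exp.eval]
  omega

/-- An expression that computes, for the fact to which the variable `i` points, the number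
`key`. -/
def Exp.Evaluates (e : ℕ → Exp) (key : DBFact k → ℕ) : Prop :=
  ∀ (L : List (DBFact k)) (p : ℕ) (s : List ℕ) (i : ℕ) (f : DBFact k), Points L s i f →
    (e i).eval (inputState L).mem p s = key f

variable (k) in
/-- The number `Side.major` of the fact to which the variable `i` points. -/
def Side.majorExp : Side → ℕ → Exp
  | left => Exp.xArg k
  | right => Exp.yArg k

variable (k) in
/-- The number `Side.minor` of the fact to which the variable `i` points. -/
def Side.minorExp : Side → ℕ → Exp
  | left => Exp.yArg k
  | right => Exp.xArg k

theorem Side.evaluates_majorExp (s : Side) :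
    Exp.Evaluates (s.majorExp k) (s.major : DBFact k → ℕ) := by
  cases s
  · exact fun _ _ _ _ _ => eval_xArg
  · exact fun _ _ _ _ _ => eval_yArg

theorem Side.evaluates_minorExp (s : Side) :
    Exp.Evaluates (s.minorExp k) (s.minor : DBFact k → ℕ) := by
  cases s
  · exact fun _ _ _ _ _ => eval_yArg
  · exact fun _ _ _ _ _ => eval_xArg

/-- For `key i` as in `Exp.Evaluates`, an expression that counts the facts before the one to which
the innermost variable points that have the same key. -/
def Exp.repeats (key : ℕ → Exp) : Exp :=
  .sum (.sub (.const 1) (.add (.sub (.const 1) (.sub (.var 1) (.var 0))) ((key 0).dist (key 1))))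

theorem Points.of_prefix {K : List (DBFact k)} (hK : K ++ [f] <+: L) :
    Points L (K.length :: s) 0 f := by
  obtain ⟨K', rfl⟩ := hK
  exact ⟨_, rfl, by simp⟩

theorem eval_repeats_eq_zero_iff {K : List (DBFact k)} {keyExp : ℕ → Exp} {key : DBFact k → ℕ}
    (hkey : Exp.Evaluates keyExp key) (hK : K ++ [f] <+: L) :
    (Exp.repeats keyExp).eval (inputState L).mem p (K.length :: s) = 0 ↔ key f ∉ K.map key := by
  have hlen : (inputState L).mem 0 = L.length := rfl
  obtain ⟨K', hK'⟩ := (List.prefix_append _ _).trans hK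
  have hsame {j : ℕ} {g : DBFact k} (hg : K[j]? = some g) :
      (((keyExp 0).dist (keyExp 1)).eval (inputState L).mem p (j :: K.length :: s) = 0) ↔
        key g = key f := by
    have hgL : L[j]? = some g := by
      rw [← hK', List.getElem?_append_left (List.getElem?_eq_some_iff.mp hg).1, hg]
    rw [eval_dist_eq_zero_iff, hkey L _ _ 0 g ⟨j, rfl, hgL⟩,
      hkey L _ _ 1 f ((Points.of_prefix hK).shift j)]
  simp only [Exp.repeats, Exp.eval, Finset.sum_eq_zero_iff, Finset.mem_range, hlen, List.mem_map,
    not_exists, not_and, List.getD_cons_zero, List.getD_cons_succ]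
  constructor
  · intro h g hg heq
    obtain ⟨j, hj, rfl⟩ := List.getElem_of_mem hg
    have := h j (hj.trans_le (by simp [← hK']))
    rw [(hsame (List.getElem?_eq_getElem hj)).mpr heq] at this
    omega
  · intro h j _
    rcases lt_or_ge j K.length with hj | hj
    · have := mt (hsame (List.getElem?_eq_getElem hj)).mp (h _ (List.getElem_mem hj))
      omega
    · omega

end Facts

/-! ### Writing the circuit of the automaton -/

section Loops

variable {k : ℕ} {α : Type*} [Finite α] {L : List (DBFact k)} {s : List ℕ}
  {G : List (Gate (DBFact k))}

theorem run_forEach {body : Cmd} (W : List (DBFact k) → List (Step α (DBFact k))) (hnil : W [] = [])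
    (h : ∀ K f, K ++ [f] <+: L → ∃ v, W (K ++ [f]) = v ++ W K ∧
      ∀ G, body.run (inputState L).mem (K.length :: s) (tape G) = tape (simulate G v)) :
    (Cmd.forEach body).run (inputState L).mem s (tape G) = tape (simulate G (W L)) := by
  suffices ∀ K, K <+: L → ∀ G, (List.range K.length).foldr
      (fun j => body.run (inputState L).mem (j :: s)) (tape G) = tape (simulate G (W K)) from
    this L List.prefix_rfl G
  intro K
  induction K using List.reverseRecOn with
  | nil => simp [hnil, simulate]
  | append_singleton K f ih =>
    intro hK G
    obtain ⟨v, hv, hbody⟩ := h K f hK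
    rw [List.length_append, List.length_singleton, List.range_succ, List.foldr_append,
      List.foldr_cons, List.foldr_nil, hbody, ih ((List.prefix_append _ _).trans hK), hv]
    simp [simulate]

theorem run_forEach_filter {body : Cmd} (P : DBFact k → Prop)
    [DecidablePred P] (st : DBFact k → Step α (DBFact k))
    (h : ∀ j f, Points L (j :: s) 0 f → ∀ G, body.run (inputState L).mem (j :: s) (tape G) =
      if P f then tape (simulate G [st f]) else tape G) :
    (Cmd.forEach body).run (inputState L).mem s (tape G) =
      tape (simulate G ((L.reverse.filter P).map st)) := by
  refine run_forEach (fun K => (K.reverse.filter P).map st) rfl fun K f hK =>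
    ⟨if P f then [st f] else [], ?_, fun G => ?_⟩
  · split_ifs with hP <;> simp [hP]
  · rw [h _ f (.of_prefix hK)]
    split_ifs <;> rfl

/-- Runs `body` for one fact for each value of `key`, which is as in `Exp.Evaluates`. -/
def forEachKey (key : ℕ → Exp) (body : Cmd) : Cmd :=
  .forEach (.ifZero (.repeats key) body .skip)

theorem run_forEachKey {keyExp : ℕ → Exp} {key : DBFact k → ℕ} (hkey : Exp.Evaluates keyExp key)
    {body : Cmd} {w : ℕ → List (Step α (DBFact k))}
    (h : ∀ j f, Points L (j :: s) 0 f → ∀ G,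
      body.run (inputState L).mem (j :: s) (tape G) = tape (simulate G (w (key f)))) :
    (forEachKey keyExp body).run (inputState L).mem s (tape G) =
      tape (simulate G ((L.reverse.map key).dedup.flatMap w)) := by
  refine run_forEach (fun K => (K.reverse.map key).dedup.flatMap w) rfl fun K f hK =>
    ⟨if key f ∈ K.map key then [] else w (key f), ?_, fun G => ?_⟩
  · rw [List.reverse_append, List.reverse_singleton, List.singleton_append, List.map_cons,
      List.map_reverse, List.dedup_cons]
    split_ifs <;> simp_all
  · rw [Cmd.run, ite_cond_congr (propext (eval_repeats_eq_zero_iff hkey hK))]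
    split_ifs with hmem
    · rfl
    · exact h _ f (.of_prefix hK) G

end Loops

section StepCommands

variable {k : ℕ} {α : Type*} [Finite α] {M : ℕ → ℕ} {s : List ℕ} {G : List (Gate (DBFact k))}

/-- Writes a layer with the constant state `a`. -/
noncomputable def initialCmd (a : α) : Cmd :=
  .bind .pos <| writeGates <| andWords [] :: mapWords newRef fun _ : Unit => a

theorem run_initialCmd (a : α) :
    (initialCmd a).run M s (tape G) = tape (G ++ initialGates G.length a) := by
  refine run_writeGates fun p => ?_
  rw [List.map_cons, map_andWords (k := k), map_mapWords (k := k) (S := G.length) fun c => rfl]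
  rfl

/-- Writes the gates that simulate `Step.map g`. -/
noncomputable def mapCmd (g : α → α) : Cmd :=
  .bind .pos <| writeGates <| mapWords (oldRef (Nat.card α)) g

theorem run_mapCmd (g : α → α) :
    (mapCmd g).run M s (tape G) = tape (simulate G [.map g]) :=
  run_writeGates fun _ => map_mapWords (fun _ => rfl) g

/-- Writes the gates that simulate `Step.read f δ`, where `f` is the fact to which the innermost
variable points. -/
noncomputable def readCmd (δ : α → α) : Cmd :=
  .bind .pos <| writeGates <|
    [.const 0, .word 1 0, .word 1 1, .word 1 2] :: [.const 1, .var 0] ::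
      (pairWords α (oldRef (Nat.card α)) ++
        mapWords (fun c => newRef (2 + c)) fun p : α × Bool => if p.2 then δ p.1 else p.1)

theorem run_readCmd {L : List (DBFact k)} {f : DBFact k} (h : Points L s 0 f) (δ : α → α) :
    (readCmd δ).run (inputState L).mem s (tape G) = tape (simulate G [.read f δ]) := by
  refine run_writeGates fun p => ?_
  have hcode : [f.code.getD 0 0, f.code.getD 1 0, f.code.getD 2 0] = f.code := by cases f <;> rfl
  have hshift : Points L (G.length :: s) 1 f := h.shift _
  have hword {c : ℕ} (hc : c < 3) := eval_word (p := p) hshift hc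
  have hold (c : ℕ) : (oldRef (Nat.card α) c).eval (inputState L).mem p (G.length :: s) =
      G.length - Nat.card α + c := rfl
  have hnew (c : ℕ) : (newRef (2 + c)).eval (inputState L).mem p (G.length :: s) =
      G.length + 2 + c := (Nat.add_assoc _ _ _).symm
  have hpos : (tape G).1 = G.length := rfl
  simp only [hpos, List.map_cons, List.map_append, map_pairWords (k := k) hold,
    map_mapWords (k := k) hnew, Step.gates, readGates, Gate.code, Exp.eval, List.map_nil,
    hword (by omega : 0 < 3), hword (by omega : 1 < 3), hword (by omega : 2 < 3), hcode,
    List.getD_cons_zero]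

/-- Writes the `∨`-gate over those gates of the last layer whose states satisfy `P`. -/
noncomputable def acceptCmd (P : α → Prop) : Cmd :=
  .bind .pos <| writeGate <| acceptWords (oldRef (Nat.card α)) P

theorem run_acceptCmd (P : α → Prop) :
    (acceptCmd P).run M s (tape G) = tape (G ++ [acceptGate (G.length - Nat.card α) P]) :=
  run_writeGate_tape (map_acceptWords (fun _ => rfl) P)

/-- Runs `p a`, where `a` is the value of `e`. -/
def switch (e : Exp) {n : ℕ} (p : Fin n → Cmd) : Cmd :=
  (List.finRange n).foldr (fun (a : Fin n) c => .ifZero (e.dist (.const a)) (p a) c) .skip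

theorem run_switch {e : Exp} {n : ℕ} (p : Fin n → Cmd) {a : Fin n} {w : ℕ × List ℕ}
    (h : e.eval M w.1 s = a) : (switch e p).run M s w = (p a).run M s w := by
  suffices ∀ l : List (Fin n), a ∈ l →
      (l.foldr (fun (a : Fin n) c => Cmd.ifZero (e.dist (.const a)) (p a) c) .skip).run M s w =
        (p a).run M s w from this _ (List.mem_finRange a)
  intro l ha
  induction l with
  | nil => simp at ha
  | cons b l ih =>
    rw [List.foldr_cons, Cmd.run, ite_cond_congr (propext eval_dist_eq_zero_iff), h, Exp.eval]
    split_ifs with hab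
    · rw [Fin.ext hab]
    · exact ih (List.mem_of_ne_of_mem (fun h => hab (congrArg _ h)) ha)

end StepCommands

namespace Side

variable {k : ℕ} {L : List (DBFact k)} {G : List (Gate (DBFact k))} {s : Side} {l : Fin (k + 1)}

variable (s) in
/-- Simulates `Side.readStep` if the fact to which the innermost variable points is relevant for
the queries before `l`. -/
noncomputable def readFact (l : Fin (k + 1)) : Cmd :=
  switch (.rel 0) fun a => if s.reflect a ≤ (s.reflect l).castSucc then
    readCmd (Memory.read (s.reflect a)) else .skip

theorem run_readFact {f : DBFact k} {v : List ℕ} (h : Points L v 0 f) :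
    (s.readFact l).run (inputState L).mem v (tape G) =
      if s.Relevant l f then tape (simulate G [s.readStep f]) else tape G := by
  rw [readFact, run_switch _ (eval_rel h)]
  by_cases hf : s.reflect f.rel ≤ (s.reflect l).castSucc
  · rw [if_pos hf, if_pos (show s.Relevant l f from hf)]
    exact run_readCmd h _
  · rw [if_neg hf, if_neg (show ¬ s.Relevant l f from hf)]
    rfl

variable (s) in
/-- Simulates `Side.cellScript` for the major of the fact to which the variable 1 points and the
minor of the fact to which the variable 0 points. -/
noncomputable def cellCmd (l : Fin (k + 1)) : Cmd :=
  .seq (.forEach (.ifZero (.add ((s.majorExp k 0).dist (s.majorExp k 2))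
      ((s.minorExp k 0).dist (s.minorExp k 1))) (s.readFact l) .skip))
    (mapCmd (Memory.clearCell (k := k)))

theorem run_cellCmd {f g : DBFact k} {v : List ℕ} (hg : Points L v 0 g) (hf : Points L v 1 f) :
    (s.cellCmd l).run (inputState L).mem v (tape G) =
      tape (simulate G (s.cellScript l L.reverse (s.major f) (s.minor g))) := by
  rw [cellCmd, Cmd.run, run_forEach_filter (fun h => s.major h = s.major f ∧
    s.minor h = s.minor g ∧ s.Relevant l h) s.readStep fun j h hh G => ?_, run_mapCmd]
  · simp [cellScript, simulate]
  · have hcell : (Exp.add ((s.majorExp k 0).dist (s.majorExp k 2))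
        ((s.minorExp k 0).dist (s.minorExp k 1))).eval (inputState L).mem (tape G).1 (j :: v) = 0 ↔
        s.major h = s.major f ∧ s.minor h = s.minor g := by
      rw [Exp.eval, Nat.add_eq_zero_iff, eval_dist_eq_zero_iff, eval_dist_eq_zero_iff,
        s.evaluates_majorExp _ _ _ _ _ hh, s.evaluates_majorExp _ _ _ _ _ (hf.shift j),
        s.evaluates_minorExp _ _ _ _ _ hh, s.evaluates_minorExp _ _ _ _ _ (hg.shift j)]
    rw [Cmd.run, ite_cond_congr (propext hcell), run_readFact hh]
    simp [Cmd.run, ← ite_and, and_assoc]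

variable (s) in
/-- Simulates `Side.groupScript` for the group of the fact to which the innermost variable
points. -/
noncomputable def groupCmd (l : Fin (k + 1)) : Cmd :=
  .seq (forEachKey (s.minorExp k) (s.cellCmd l)) (mapCmd (Memory.clearGroup (k := k)))

theorem run_groupCmd {f : DBFact k} {v : List ℕ} (hf : Points L v 0 f) :
    (s.groupCmd l).run (inputState L).mem v (tape G) =
      tape (simulate G (s.groupScript l L.reverse (s.major f))) := by
  rw [groupCmd, Cmd.run, run_forEachKey s.evaluates_minorExp
    fun j g hg G => run_cellCmd hg (hf.shift j), run_mapCmd]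
  simp [groupScript, simulate]

variable (s) in
/-- Writes a circuit whose last gate tests whether the queries before `l` that hold are those
in `N`. -/
noncomputable def matchCmd (l : Fin (k + 1)) (N : Finset (Fin (k + 1))) : Cmd :=
  .seq (initialCmd (⟨∅, ∅, ∅⟩ : Memory k)) <|
    .seq (forEachKey (s.majorExp k) (s.groupCmd l)) (acceptCmd (s.Matches l N))

variable (s) in
/-- The gates that `Side.matchCmd` appends to the circuit `G`. -/
noncomputable def matchCircuit (G : List (Gate (DBFact k))) (l : Fin (k + 1))
    (N : Finset (Fin (k + 1))) (L : List (DBFact k)) : List (Gate (DBFact k)) :=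
  let G' := simulate (G ++ initialGates G.length (⟨∅, ∅, ∅⟩ : Memory k)) (s.script l L.reverse)
  G' ++ [acceptGate (G'.length - Nat.card (Memory k)) (s.Matches l N)]

theorem run_matchCmd (N : Finset (Fin (k + 1))) (v : List ℕ) :
    (s.matchCmd l N).run (inputState L).mem v (tape G) = tape (s.matchCircuit G l N L) := by
  rw [matchCmd, Cmd.run, Cmd.run, run_initialCmd,
    run_forEachKey s.evaluates_majorExp fun j f hf G => run_groupCmd hf, run_acceptCmd]
  rfl

end Side

/-! ### Circuits for sets of valuations -/

section Programs

variable {k : ℕ} {L : List (DBFact k)} {p q : Cmd} {χ χ' ψ : Set (DBFact k) → Prop}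
  {d d' e : Set (DBFact k)}

/-- On the input `L`, the command `p` extends every list of gates of a d-D over the facts in `L`
by gates the last of which captures `χ` and depends on variables in `d` only. -/
def Writes (L : List (DBFact k)) (p : Cmd) (χ : Set (DBFact k) → Prop) (d : Set (DBFact k)) :
    Prop :=
  ∀ G s, IsDDList {f | f ∈ L} G → ∃ G', G <+: G' ∧ G.length < G'.length ∧
    p.run (inputState L).mem s (tape G) = tape G' ∧ IsDDList {f | f ∈ L} G' ∧
    Computes G' (G'.length - 1) χ d

/-- The number of the gate written last. -/
def lastGate : Exp := .sub .pos (.const 1)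

/-- Runs `p`, then `q`, and then writes the gate with the given words, in which `Exp.var 0` refers
to the last gate of `p` and `lastGate` to that of `q`. -/
def combine (p q : Cmd) (words : List Exp) : Cmd :=
  .seq p (.bind lastGate (.seq q (writeGate words)))

namespace Writes

theorem imp (h : Writes L p χ d) (hχ : ∀ ν, χ ν ↔ χ' ν) (hd : d ⊆ d') : Writes L p χ' d' :=
  fun G s hG =>
    let ⟨G', hprefix, hlt, hrun, hG', hχ'⟩ := h G s hG
    ⟨G', hprefix, hlt, hrun, hG', hχ'.imp hχ hd⟩

theorem combine {words : List Exp} {g : ℕ → ℕ → Gate (DBFact k)} (hp : Writes L p χ d)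
    (hq : Writes L q χ' d')
    (hwords : ∀ n i (s : List ℕ),
      words.map (Exp.eval (inputState L).mem n (i :: s)) = (g i (n - 1)).code)
    (hg : ∀ {G i j}, Computes G i χ d → Computes G j χ' d' → i ≠ j →
      Realizes {f | f ∈ L} G (g i j) ψ e) : Writes L (HQueries.combine p q words) ψ e := by
  intro G s hG
  obtain ⟨G₁, hprefix₁, hlt₁, hrun₁, hG₁, hχ⟩ := hp G s hG
  obtain ⟨G₂, hprefix₂, hlt₂, hrun₂, hG₂, hχ'⟩ := hq G₁ ((G₁.length - 1) :: s) hG₁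
  have hlast := hg (hχ.of_prefix hprefix₂) hχ' (by omega)
  refine ⟨_, hprefix₁.trans (hprefix₂.trans (List.prefix_append _ _)), ?_, ?_,
    hG₂.concat hlast.fits, by simpa using hlast.computes⟩
  · simpa using (hlt₁.trans hlt₂).le
  · rw [HQueries.combine, Cmd.run, Cmd.run, hrun₁]
    exact (congrArg _ hrun₂).trans (run_writeGate_tape (hwords _ _ _))

theorem and (hp : Writes L p χ d) (hq : Writes L q χ' d') (hd : Disjoint d d') :
    Writes L (HQueries.combine p q (andWords [.var 0, lastGate])) (fun ν => χ ν ∧ χ' ν) (d ∪ d') :=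
  hp.combine hq (fun _ _ _ => map_andWords _) fun hi hj hij => .and_pair hi hj hij hd

theorem or (hp : Writes L p χ d) (hq : Writes L q χ' d) (hdet : ∀ ν, ¬(χ ν ∧ χ' ν)) :
    Writes L (HQueries.combine p q (orWords [.var 0, lastGate])) (fun ν => χ ν ∨ χ' ν) d :=
  hp.combine hq (fun _ _ _ => map_orWords _) fun hi hj hij => .or_pair hi hj hij hdet

theorem neg (hp : Writes L p χ d) :
    Writes L (.seq p (writeGate [.const 1, lastGate])) (fun ν => ¬χ ν) d := by
  intro G s hG
  obtain ⟨G', hprefix, hlt, hrun, hG', hχ⟩ := hp G s hG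
  have hneg : Realizes {f | f ∈ L} G' (.neg (G'.length - 1)) (fun ν => ¬χ ν) d := .neg hχ
  refine ⟨_, hprefix.trans (List.prefix_append _ _), ?_, ?_, hG'.concat hneg.fits,
    by simpa using hneg.computes⟩
  · simpa using hlt.le
  · rw [Cmd.run, hrun]
    exact run_writeGate_tape rfl

theorem false : Writes L (writeGate (orWords [])) (fun _ => False) d := by
  intro G s hG
  have hfalse : Realizes {f | f ∈ L} G (.or []) (fun _ => False) d :=
    (Realizes.or_map (ι := Empty) (l := []) (p := nofun) (s := nofun) nofun .nil nofun).imp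
      (by simp) subset_rfl
  exact ⟨_, List.prefix_append _ _, by simp, run_writeGate_tape rfl, hG.concat hfalse.fits,
    by simpa using hfalse.computes⟩

theorem matchCmd (hL : L.Nodup) (s : Side) (l : Fin (k + 1)) (N : Finset (Fin (k + 1))) :
    Writes L (s.matchCmd l N)
      (fun ν => ∀ i, s.reflect i < s.reflect l → (i ∈ heldQueries ({f | f ∈ L} ∩ ν) ↔ i ∈ N))
      {f | s.Relevant l f} := by
  intro G v hG
  obtain ⟨hG₀, hlayer₀⟩ := layer_initialGates hG (⟨∅, ∅, ∅⟩ : Memory k)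
  obtain ⟨hG₁, hlayer⟩ := hlayer₀.simulate hG₀
    (s.nodup_flatMap_reads_script (l := l) (List.nodup_reverse.mpr hL))
    (fun f hf => List.mem_reverse.mp (Side.mem_flatMap_reads_script.mp hf).1) fun f _ => id
  have haccept := hlayer.realizes_acceptGate (D := {f | f ∈ L}) (s.Matches l N)
  have hprefix := (List.prefix_append G _).trans (prefix_simulate
    (G ++ initialGates G.length (⟨∅, ∅, ∅⟩ : Memory k)) (s.script l L.reverse))
  refine ⟨s.matchCircuit G l N L, hprefix.trans (List.prefix_append _ _), ?_, s.run_matchCmd N v,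
    hG₁.concat haccept.fits, ?_⟩
  · simpa [Side.matchCircuit, Nat.lt_succ_iff] using hprefix.length_le
  · have hlast := haccept.computes.imp (s' := fun ν => ∀ i, s.reflect i < s.reflect l →
      (i ∈ heldQueries ({f | f ∈ L} ∩ ν) ↔ i ∈ N)) (d' := {f | s.Relevant l f}) (fun ν => ?_)
      fun f hf => ?_
    · simpa [Side.matchCircuit] using hlast
    · rw [Side.runAll_script, ← Side.matches_memory_iff]
      simp only [List.mem_reverse, Set.mem_inter_iff, Set.mem_ofPred_eq, and_right_comm]
    · rw [Set.empty_union] at hf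
      exact (Side.mem_flatMap_reads_script.mp hf).2

theorem exists_pair (l : Fin (k + 1)) (N : Finset (Fin (k + 1))) :
    ∃ p : Cmd, ∀ L : List (DBFact k), L.Nodup → Writes L p
      (fun ν => heldQueries ({f | f ∈ L} ∩ ν) ∈ ({N, N ∆ {l}} : Finset _)) Set.univ := by
  refine ⟨_, fun L hL => ((matchCmd hL .left l N).and (matchCmd hL .right l N)
    (Side.disjoint_relevant l)).imp (fun ν => ?_) (Set.subset_univ _)⟩
  simp only [← forall_ne_mem_iff_mem_pair, ← Side.reflect_lt_reflect_iff_ne, or_imp, forall_and]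

theorem exists_of_pairReachable {A : Finset (Finset (Fin (k + 1)))} (hA : PairReachable A) :
    ∃ p : Cmd, ∀ L : List (DBFact k), L.Nodup →
      Writes L p (fun ν => heldQueries ({f | f ∈ L} ∩ ν) ∈ A) Set.univ := by
  induction hA with
  | empty => exact ⟨_, fun L _ => by simpa using Writes.false⟩
  | @toggle A _ N l hN ih =>
    obtain ⟨p, hp⟩ := ih
    obtain ⟨q, hq⟩ := exists_pair l N
    by_cases hmem : N ∈ A
    · have hsub : {N, N ∆ {l}} ⊆ A :=
        Finset.insert_subset hmem (Finset.singleton_subset_iff.mpr (hN.mp hmem))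
      refine ⟨_, fun L hL => ((hp L hL).neg.or (hq L hL) ?_).neg.imp (fun ν => ?_) subset_rfl⟩
      · exact fun ν ⟨hnot, hpair⟩ => hnot (hsub hpair)
      · rw [symmDiff_of_ge hsub, Finset.mem_sdiff, not_or, not_not]
    · have hdisj : Disjoint A {N, N ∆ {l}} := by
        simp [hmem, mt hN.mpr hmem]
      refine ⟨_, fun L hL => ((hp L hL).or (hq L hL) ?_).imp (fun ν => ?_) subset_rfl⟩
      · exact fun ν ⟨hA, hpair⟩ => Finset.disjoint_left.mp hdisj hA hpair
      · rw [hdisj.symmDiff_eq_sup, Finset.sup_eq_union, Finset.mem_union]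

end Writes

theorem inDDPTIME_of_writes {Q : Query k}
    (h : ∀ L : List (DBFact k), L.Nodup → Writes L p (fun ν => Q ({f | f ∈ L} ∩ ν)) Set.univ) :
    InDDPTIME Q := by
  refine ⟨p.compile [] 1, (p.compile [] 1).cost, fun D L hL hD => ?_⟩
  obtain ⟨G, -, hlt, hrun, hG, hQ⟩ := h L hL [] [] isDDList_nil
  obtain ⟨t, τ, hexec, ht, hτ⟩ :=
    p.compilesCorrectly (ρ := []) (r := 1) (by simp) one_pos (inputState L)
  have hwritten : (τ.reg 0, τ.out) = tape G := hτ.written.trans hrun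
  have hcard : D.card = L.length := by
    classical
    rw [← List.toFinset_card_of_nodup hL]
    congr 1
    ext x
    simp [hD]
  have hne : G ≠ [] := List.ne_nil_of_length_pos hlt
  refine ⟨t, τ, hG.toCircuit hne, hexec, hcard ▸ ht, congrArg Prod.snd hwritten, hG.isDD hne,
    fun x hx => (hD x).mp (hG.mem_of_var_mem hx), fun D' hD' => ?_⟩
  have hinter : {f | f ∈ L} ∩ D' = D' := Set.inter_eq_right.mpr fun x hx => (hD x).mpr (hD' hx)
  exact (hQ.val D').trans (by rw [hinter])

end Programs

end HQueries

theorem mainTheorem1 (k : ℕ) (hk : 1 ≤ k) (φ : HQueries.BoolFun k)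
    (hφ : HQueries.eulerChar φ = 0) : HQueries.InDDPTIME (HQueries.queryOf φ) := by
  have hreach : HQueries.PairReachable (Finset.univ.filter fun ν => φ ν = true) :=
    .of_signedCount_eq_zero hφ
  obtain ⟨p, hp⟩ := HQueries.Writes.exists_of_pairReachable hreach
  refine HQueries.inDDPTIME_of_writes fun L hL => (hp L hL).imp (fun ν => ?_) subset_rfl
  rw [Finset.mem_filter_univ]
  rfl
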